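/- Let $p$ be a prime, $F$ a $p$-adic field (a complete valued extension of $\mathbb{Q}_p$), and $\mathcal{O}_1,\mathcal{O}_2$ commutative (non-archimedean) Banach $F$-algebras with completed tensor product $\mathcal{O}_1\widehat\otimes\mathcal{O}_2$ over $F$. Let $k_i:\mathbb{Z}_p^\times\to\mathcal{O}_i^\times$ ($i=1,2$) be locally analytic characters, and let $k_1\boxplus k_2:(\mathbb{Z}_p^\times)^2\to(\mathcal{O}_1\widehat\otimes\mathcal{O}_2)^\times$ be the character $(t_1,t_2)\mapsto k_1(t_1)\otimes k_2(t_2)$. Let $W=\mathbb{Z}_p^\times\times\mathbb{Z}_p$, a set of row vectors on which $\mathbb{Z}_p^\times$ acts by scaling, and on which the semigroup $\Sigma_0(p\mathbb{Z}_p)$ of matrices $\begin{pmatrix}a&b\\c&d\end{pmatrix}\in \mathbf{M}_2(\mathbb{Z}_p)$ with non-zero determinant, $a\in\mathbb{Z}_p^\times$ and $c\in p\mathbb{Z}_p$ acts from the right; it acts diagonally on $W\times W$. Let $(W\times W)_0\subset W\times W$ be the open and closed subset of the pairs $((x_1,y_1),(x_2,y_2))$ with $x_1y_2-x_2y_1\in\mathbb{Z}_p^\times$.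 For $X$ one of $W$, $W\times W$, $(W\times W)_0$, with its torus $T=\mathbb{Z}_p^\times$ or $(\mathbb{Z}_p^\times)^2$ acting by scaling the components, and a locally analytic character $\kappa:T\to\mathcal{O}^\times$, let $\mathcal{A}_\kappa(X)$ be the module of locally analytic functions $f:X\to\mathcal{O}$ with $f(tx)=\kappa(t)f(x)$, and let $\mathcal{D}_\kappa(X)$ be the module of continuous $\mathcal{O}$-linear functionals on $\mathcal{A}_\kappa(X)$ (these $X$ being trivial $T$-bundles, this is canonically $\mathcal{O}\widehat\otimes_\kappa\mathcal{D}(X)$). For $X=W$ and $X=W\times W$ the semigroup $\Sigma_0(p\mathbb{Z}_p)$ acts on the right by $(\mu g)(f)=\mu(x\mapsto f(xg))$. Let $\mu\mapsto\mu^0$, $\mathcal{D}_{k_1\boxplus k_2}(W\times W)\to\mathcal{D}_{k_1\boxplus k_2}((W\times W)_0)$, be the dual of extension of functions by zero, and let $i_*:\mathcal{D}_{k_1\boxplus k_2}((W\times W)_0)\to\mathcal{D}_{k_1\boxplus k_2}(W\times W)$ be the push-forward along the inclusion, i.e. the dual of restriction of functions. Let $B$ be a definite quaternion algebra over $\mathbb{Q}$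 which is split at $p$, with a fixed identification $B\otimes\mathbb{Q}_p\simeq \mathbf{M}_2(\mathbb{Q}_p)$, and let $B_f^\times=B_f^{\times,p}\times \mathrm{GL}_2(\mathbb{Q}_p)$ be the group of finite adelic points of $B^\times$, where $B_f^{\times,p}$ denotes the prime-to-$p$ part. Put $\Gamma_0(p\mathbb{Z}_p)=\Sigma_0(p\mathbb{Z}_p)\cap \mathrm{GL}_2(\mathbb{Z}_p)$. For a right $\Sigma_0(p\mathbb{Z}_p)$-module $D$, let $u\in B_f^{\times,p}\times\Sigma_0(p\mathbb{Z}_p)$ act on functions $\varphi:B_f^\times\to D$ by $(\varphi u)(x)=\varphi(ux)u_p$, and let $M_p(D)^{\Gamma_0(p\mathbb{Z}_p)}$ be the set of functions $\varphi:B_f^\times\to D$ such that $\varphi(x\gamma)=\varphi(x)$ for all $\gamma\in B^\times$ and such that $\varphi u=\varphi$ for all $u\in K:=K^p\,\Gamma_0(p\mathbb{Z}_p)$, for some open compact subgroup $K^p\subset B_f^{\times,p}$. For such $\varphi$ and $K$ put $\varphi|U_p=\sum_{x\in K\backslash K\widehat\pi_pK}\varphi x$, where $\widehat\pi_p\in B_f^\times$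 is concentrated at $p$, with component $\begin{pmatrix}1&0\\0&p\end{pmatrix}$ there; this does not depend on the choice of $K^p$. For $i=1,2$ let $\varphi_i\in M_p(\mathcal{D}_{k_i}(W))^{\Gamma_0(p\mathbb{Z}_p)}$ satisfy $\varphi_i|U_p=a_i\varphi_i$ with $a_i\in\mathcal{O}_i$. Then for every $x\in B_f^\times$ there is a unique distribution $(\varphi_1\otimes\varphi_2)(x)\in\mathcal{D}_{k_1\boxplus k_2}(W\times W)$ whose value at $(w_1,w_2)\mapsto f_1(w_1)\otimes f_2(w_2)$ is $\varphi_1(x)(f_1)\otimes\varphi_2(x)(f_2)$ for all $f_i\in\mathcal{A}_{k_i}(W)$; the function $\varphi_1\otimes\varphi_2$ belongs to $M_p(\mathcal{D}_{k_1\boxplus k_2}(W\times W))^{\Gamma_0(p\mathbb{Z}_p)}$; and $$(\varphi_1\otimes\varphi_2)|U_p=a_1a_2\big(\varphi_1\otimes\varphi_2-i_*(\varphi_1\otimes\varphi_2)^0\big),$$ where $a_1a_2=a_1\otimes a_2\in\mathcal{O}_1\widehat\otimes\mathcal{O}_2$, and where $^0$ and $i_*$ are applied value by value. -/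

import Mathlib

open scoped Quaternion TensorProduct Topology
open Filter

noncomputable section

namespace QuatForms

/-! ### The completed tensor product of two Banach algebras -/

section CompletedTensor

variable (F : Type*) (O₁ : Type*) (O₂ : Type*) [NormedField F]
  [NormedCommRing O₁] [NormedAlgebra F O₁] [NormedCommRing O₂] [NormedAlgebra F O₂]

/-- The algebraic tensor product `O₁ ⊗ O₂` over `F`, to be equipped with the projective seminorm. -/
def ProjTensor : Type _ := O₁ ⊗[F] O₂

instance : CommRing (ProjTensor F O₁ O₂) := inferInstanceAs (CommRing (O₁ ⊗[F] O₂))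

instance : Algebra F (ProjTensor F O₁ O₂) := inferInstanceAs (Algebra F (O₁ ⊗[F] O₂))

variable {O₁ O₂} in
/-- The pure tensor `a ⊗ b`. -/
def ptmul (a : O₁) (b : O₂) : ProjTensor F O₁ O₂ := a ⊗ₜ[F] b

/-- The finite sums of pure tensors `a ⊗ b` with `‖a‖ * ‖b‖ ≤ C`. -/
def tensorBall (C : ℝ) : AddSubgroup (ProjTensor F O₁ O₂) :=
  AddSubgroup.closure {s | ∃ (a : O₁) (b : O₂), ‖a‖ * ‖b‖ ≤ C ∧ s = ptmul F a b}

variable {F O₁ O₂} in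
/-- The non-archimedean projective seminorm: the infimum of `max ‖aᵢ‖ ‖bᵢ‖` over all ways of
writing `t = ∑ aᵢ ⊗ bᵢ`. -/
def projNorm (t : ProjTensor F O₁ O₂) : ℝ := sInf {C | 0 ≤ C ∧ t ∈ tensorBall F O₁ O₂ C}

variable {F O₁ O₂}

theorem tensorBall_mono {C D : ℝ} (h : C ≤ D) : tensorBall F O₁ O₂ C ≤ tensorBall F O₁ O₂ D := by
  apply AddSubgroup.closure_mono
  rintro s ⟨a, b, hab, rfl⟩
  exact ⟨a, b, hab.trans h, rfl⟩

theorem exists_tensorBall (t : ProjTensor F O₁ O₂) : ∃ C, 0 ≤ C ∧ t ∈ tensorBall F O₁ O₂ C := by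
  induction t using TensorProduct.induction_on with
  | zero => exact ⟨0, le_rfl, zero_mem _⟩
  | tmul a b => exact ⟨‖a‖ * ‖b‖, by positivity, AddSubgroup.subset_closure ⟨a, b, le_rfl, rfl⟩⟩
  | add x y hx hy =>
    obtain ⟨C, hC, hx⟩ := hx
    obtain ⟨D, hD, hy⟩ := hy
    exact ⟨max C D, le_max_of_le_left hC, add_mem (tensorBall_mono (le_max_left _ _) hx)
      (tensorBall_mono (le_max_right _ _) hy)⟩

theorem projNorm_nonneg (t : ProjTensor F O₁ O₂) : 0 ≤ projNorm t :=
  Real.sInf_nonneg fun _ h => h.1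

theorem projNorm_le {t : ProjTensor F O₁ O₂} {C : ℝ} (hC : 0 ≤ C)
    (h : t ∈ tensorBall F O₁ O₂ C) : projNorm t ≤ C :=
  csInf_le ⟨0, fun _ h => h.1⟩ ⟨hC, h⟩

theorem mem_tensorBall_of_lt {t : ProjTensor F O₁ O₂} {C : ℝ} (h : projNorm t < C) :
    t ∈ tensorBall F O₁ O₂ C := by
  obtain ⟨D, ⟨_, hD⟩, hDC⟩ := exists_lt_of_csInf_lt (exists_tensorBall t) h
  exact tensorBall_mono hDC.le hD

theorem projNorm_add_le_max (s t : ProjTensor F O₁ O₂) :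
    projNorm (s + t) ≤ max (projNorm s) (projNorm t) := by
  refine le_of_forall_gt_imp_ge_of_dense fun C hC => ?_
  rw [max_lt_iff] at hC
  exact projNorm_le ((projNorm_nonneg s).trans hC.1.le)
    (add_mem (mem_tensorBall_of_lt hC.1) (mem_tensorBall_of_lt hC.2))

theorem mul_mem_tensorBall {s t : ProjTensor F O₁ O₂} {C D : ℝ} (hC : 0 ≤ C)
    (hs : s ∈ tensorBall F O₁ O₂ C) (ht : t ∈ tensorBall F O₁ O₂ D) :
    s * t ∈ tensorBall F O₁ O₂ (C * D) := by
  refine AddSubgroup.closure_induction (p := fun x _ => x * t ∈ tensorBall F O₁ O₂ (C * D))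
    ?_ ?_ ?_ ?_ hs
  · rintro _ ⟨a, b, hab, rfl⟩
    refine AddSubgroup.closure_induction
      (p := fun y _ => ptmul F a b * y ∈ tensorBall F O₁ O₂ (C * D)) ?_ ?_ ?_ ?_ ht
    · rintro _ ⟨c, d, hcd, rfl⟩
      refine AddSubgroup.subset_closure ⟨a * c, b * d, ?_,
        Algebra.TensorProduct.tmul_mul_tmul a c b d⟩
      calc ‖a * c‖ * ‖b * d‖ ≤ (‖a‖ * ‖c‖) * (‖b‖ * ‖d‖) := by
            gcongr <;> exact norm_mul_le _ _
        _ = (‖a‖ * ‖b‖) * (‖c‖ * ‖d‖) := by ring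
        _ ≤ C * D := by gcongr
    · rw [mul_zero]; exact zero_mem _
    · intro x y _ _ h1 h2; rw [mul_add]; exact add_mem h1 h2
    · intro x _ h; rw [mul_neg]; exact neg_mem h
  · rw [zero_mul]; exact zero_mem _
  · intro x y _ _ h1 h2; rw [add_mul]; exact add_mem h1 h2
  · intro x _ h; rw [neg_mul]; exact neg_mem h

theorem smul_mem_tensorBall {t : ProjTensor F O₁ O₂} {C : ℝ} (c : F)
    (ht : t ∈ tensorBall F O₁ O₂ C) : c • t ∈ tensorBall F O₁ O₂ (‖c‖ * C) := by
  refine AddSubgroup.closure_induction (p := fun x _ => c • x ∈ tensorBall F O₁ O₂ (‖c‖ * C))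
    ?_ ?_ ?_ ?_ ht
  · rintro _ ⟨a, b, hab, rfl⟩
    refine AddSubgroup.subset_closure ⟨c • a, b, ?_, TensorProduct.smul_tmul' c a b⟩
    calc ‖c • a‖ * ‖b‖ ≤ ‖c‖ * ‖a‖ * ‖b‖ := by gcongr; exact norm_smul_le _ _
      _ = ‖c‖ * (‖a‖ * ‖b‖) := by ring
      _ ≤ ‖c‖ * C := by gcongr
  · rw [smul_zero]; exact zero_mem _
  · intro x y _ _ h1 h2; rw [smul_add]; exact add_mem h1 h2
  · intro x _ h; rw [smul_neg]; exact neg_mem h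

theorem projNorm_mul_le (s t : ProjTensor F O₁ O₂) :
    projNorm (s * t) ≤ projNorm s * projNorm t := by
  have h : ∀ ε : ℝ, 0 < ε → projNorm (s * t) ≤ (projNorm s + ε) * (projNorm t + ε) := by
    intro ε hε
    have h1 := projNorm_nonneg s
    have h2 := projNorm_nonneg t
    exact projNorm_le (by positivity) (mul_mem_tensorBall (by positivity)
      (mem_tensorBall_of_lt (by linarith)) (mem_tensorBall_of_lt (by linarith)))
  have hl : Tendsto (fun ε : ℝ => (projNorm s + ε) * (projNorm t + ε)) (𝓝[>] 0)
      (𝓝 ((projNorm s + 0) * (projNorm t + 0))) := by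
    refine Tendsto.mono_left (Continuous.tendsto ?_ 0) nhdsWithin_le_nhds
    fun_prop
  rw [add_zero, add_zero] at hl
  exact ge_of_tendsto hl (eventually_nhdsWithin_of_forall fun ε hε => h ε hε)

theorem projNorm_smul_le (c : F) (t : ProjTensor F O₁ O₂) :
    projNorm (c • t) ≤ ‖c‖ * projNorm t := by
  have h : ∀ ε : ℝ, 0 < ε → projNorm (c • t) ≤ ‖c‖ * (projNorm t + ε) := by
    intro ε hε
    have h2 := projNorm_nonneg t
    exact projNorm_le (by positivity) (smul_mem_tensorBall c (mem_tensorBall_of_lt (by linarith)))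
  have hl : Tendsto (fun ε : ℝ => ‖c‖ * (projNorm t + ε)) (𝓝[>] 0)
      (𝓝 (‖c‖ * (projNorm t + 0))) := by
    refine Tendsto.mono_left (Continuous.tendsto ?_ 0) nhdsWithin_le_nhds
    fun_prop
  rw [add_zero] at hl
  exact ge_of_tendsto hl (eventually_nhdsWithin_of_forall fun ε hε => h ε hε)

variable (F O₁ O₂) in
/-- The projective seminorm as a ring seminorm. -/
def projRingSeminorm : RingSeminorm (ProjTensor F O₁ O₂) where
  toFun := projNorm
  map_zero' := le_antisymm (projNorm_le le_rfl (zero_mem _)) (projNorm_nonneg _)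
  add_le' s t := (projNorm_add_le_max s t).trans
    (max_le_add_of_nonneg (projNorm_nonneg s) (projNorm_nonneg t))
  neg' t := by
    simp only [projNorm, neg_mem_iff]
  mul_le' := projNorm_mul_le

instance : SeminormedCommRing (ProjTensor F O₁ O₂) where
  __ := (projRingSeminorm F O₁ O₂).toSeminormedRing
  mul_comm := mul_comm

instance : NormedAlgebra F (ProjTensor F O₁ O₂) where
  norm_smul_le := projNorm_smul_le

variable (F O₁ O₂) in
/-- The completed tensor product `O₁ ⊗̂ O₂` over `F`: the completion of `O₁ ⊗ O₂` for the
projective seminorm.  It is again a Banach `F`-algebra. -/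
abbrev CTensor : Type _ := UniformSpace.Completion (ProjTensor F O₁ O₂)

instance : IsUltrametricDist (CTensor F O₁ O₂) := by
  refine IsUltrametricDist.isUltrametricDist_of_forall_norm_add_le_max_norm fun x y => ?_
  induction x, y using UniformSpace.Completion.induction_on₂ with
  | hp => exact isClosed_le (by fun_prop) (by fun_prop)
  | ih s t =>
    rw [← UniformSpace.Completion.coe_add]
    simp only [UniformSpace.Completion.norm_coe]
    exact projNorm_add_le_max s t

variable (F O₁ O₂) in
/-- `a ↦ a ⊗ 1`. -/
def inl : O₁ →+* CTensor F O₁ O₂ :=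
  (UniformSpace.Completion.coeRingHom (α := ProjTensor F O₁ O₂)).comp
    (Algebra.TensorProduct.includeLeftRingHom (R := F) (A := O₁) (B := O₂))

variable (F O₁ O₂) in
/-- `b ↦ 1 ⊗ b`. -/
def inr : O₂ →+* CTensor F O₁ O₂ :=
  (UniformSpace.Completion.coeRingHom (α := ProjTensor F O₁ O₂)).comp
    (Algebra.TensorProduct.includeRight (R := F) (A := O₁) (B := O₂)).toRingHom

end CompletedTensor

/-! ### Locally analytic functions -/

section Analytic

variable {p : ℕ} [Fact p.Prime] {ι : Type*} [Fintype ι]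

/-- The monomial `z ^ α`. -/
def monom (z : ι → ℚ_[p]) (α : ι →₀ ℕ) : ℚ_[p] := ∏ i, z i ^ α i

variable (F : Type*) [NormedField F] [NormedAlgebra ℚ_[p] F]
  {O : Type*} [NormedCommRing O] [NormedAlgebra F O] {X : Type*}

/-- Let `X` be a manifold embedded in `ℚ_p ^ ι` by `χ`.  The function `f : X → O` has expansions
of order `n` bounded by `C` if, around every point `x` of `X`, one has
`f (x + p ^ n z) = ∑ c_α z ^ α` for all `z` in the closed unit polydisc (such that `x + p ^ n z`
lies in `X`), with coefficients `c_α` in `O` which tend to `0` and have norm at most `C`.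
When `X` is a union of balls of radius `p ^ (-n)`, the functions with such an expansion form a
Banach space, and the best `C` is its norm. -/
def HasExpansions (χ : X → ι → ℚ_[p]) (n : ℕ) (C : ℝ) (f : X → O) : Prop :=
  0 ≤ C ∧ ∀ x : X, ∃ c : (ι →₀ ℕ) → O, Tendsto c cofinite (𝓝 0) ∧ (∀ α, ‖c α‖ ≤ C) ∧
    ∀ (z : ι → ℚ_[p]) (y : X), (∀ i, ‖z i‖ ≤ 1) → (∀ i, χ y i = χ x i + (p : ℚ_[p]) ^ n * z i) →
      HasSum (fun α => algebraMap ℚ_[p] F (monom z α) • c α) (f y)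

/-- Local analyticity of a function on a compact manifold `X` embedded in `ℚ_p ^ ι` by `χ`
(by compactness, one radius of convergence serves all points). -/
def IsLocAnalytic (χ : X → ι → ℚ_[p]) (f : X → O) : Prop :=
  ∃ (n : ℕ) (C : ℝ), HasExpansions F χ n C f

variable {F} {χ : X → ι → ℚ_[p]} {n m : ℕ} {C D : ℝ} {f g : X → O}

theorem norm_monom_le {z : ι → ℚ_[p]} (hz : ∀ i, ‖z i‖ ≤ 1) (α : ι →₀ ℕ) : ‖monom z α‖ ≤ 1 := by
  rw [monom, norm_prod]
  exact Finset.prod_le_one (fun _ _ => norm_nonneg _)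
    fun i _ => by rw [norm_pow]; exact pow_le_one₀ (norm_nonneg _) (hz i)

theorem norm_algebraMap_smul_le {a : ℚ_[p]} (ha : ‖a‖ ≤ 1) (c : O) :
    ‖algebraMap ℚ_[p] F a • c‖ ≤ ‖c‖ := by
  refine (norm_smul_le _ _).trans ?_
  rw [norm_algebraMap']
  exact mul_le_of_le_one_left (norm_nonneg _) ha

theorem HasExpansions.mono_order (h : HasExpansions F χ n C f) (hnm : n ≤ m) :
    HasExpansions F χ m C f := by
  refine ⟨h.1, fun x => ?_⟩
  obtain ⟨c, hc, hC, hs⟩ := h.2 x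
  have hp : ∀ i : ι, ‖(p : ℚ_[p]) ^ (m - n)‖ ≤ 1 := fun _ => by
    rw [norm_pow]
    exact pow_le_one₀ (norm_nonneg _) (by simpa using PadicInt.norm_le_one (p : ℤ_[p]))
  have hle : ∀ α, ‖algebraMap ℚ_[p] F (monom (fun _ : ι => (p : ℚ_[p]) ^ (m - n)) α) • c α‖
      ≤ ‖c α‖ := fun α => norm_algebraMap_smul_le (norm_monom_le hp α) _
  refine ⟨fun α => algebraMap ℚ_[p] F (monom (fun _ : ι => (p : ℚ_[p]) ^ (m - n)) α) • c α,
    squeeze_zero_norm hle (tendsto_zero_iff_norm_tendsto_zero.1 hc),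
    fun α => (hle α).trans (hC α), fun z y hz hy => ?_⟩
  have := hs (fun i => (p : ℚ_[p]) ^ (m - n) * z i) y
    (fun i => by
      rw [norm_mul]; exact mul_le_one₀ (hp i) (norm_nonneg _) (hz i))
    (fun i => by
      rw [hy i, ← mul_assoc, ← pow_add, Nat.add_sub_cancel' hnm])
  convert this using 2 with α
  rw [smul_smul, ← map_mul, monom, monom, monom, ← Finset.prod_mul_distrib]
  simp only [mul_pow, mul_comm]

theorem HasExpansions.mono_bound (h : HasExpansions F χ n C f) (hCD : C ≤ D) :
    HasExpansions F χ n D f := by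
  refine ⟨h.1.trans hCD, fun x => ?_⟩
  obtain ⟨c, hc, hC, hs⟩ := h.2 x
  exact ⟨c, hc, fun α => (hC α).trans hCD, hs⟩

theorem HasExpansions.add (hf : HasExpansions F χ n C f) (hg : HasExpansions F χ n D g) :
    HasExpansions F χ n (C + D) (f + g) := by
  refine ⟨add_nonneg hf.1 hg.1, fun x => ?_⟩
  obtain ⟨c, hc, hC, hs⟩ := hf.2 x
  obtain ⟨d, hd, hD, ht⟩ := hg.2 x
  refine ⟨fun α => c α + d α, by simpa using hc.add hd,
    fun α => (norm_add_le _ _).trans (add_le_add (hC α) (hD α)), fun z y hz hy => ?_⟩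
  have := (hs z y hz hy).add (ht z y hz hy)
  simpa only [Pi.add_apply, smul_add] using this

theorem HasExpansions.smul (a : O) (hf : HasExpansions F χ n C f) :
    HasExpansions F χ n (‖a‖ * C) (a • f) := by
  refine ⟨mul_nonneg (norm_nonneg _) hf.1, fun x => ?_⟩
  obtain ⟨c, hc, hC, hs⟩ := hf.2 x
  refine ⟨fun α => a * c α, by simpa using hc.const_mul a,
    fun α => (norm_mul_le _ _).trans (by gcongr; exact hC α), fun z y hz hy => ?_⟩
  have := (hs z y hz hy).mul_left a
  simpa only [Pi.smul_apply, smul_eq_mul, mul_smul_comm] using this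

theorem HasExpansions.zero (χ : X → ι → ℚ_[p]) :
    HasExpansions F χ 0 0 (0 : X → O) :=
  ⟨le_rfl, fun _ => ⟨0, tendsto_const_nhds, by simp, fun z y _ _ => by simp⟩⟩

theorem IsLocAnalytic.add (hf : IsLocAnalytic F χ f) (hg : IsLocAnalytic F χ g) :
    IsLocAnalytic F χ (f + g) := by
  obtain ⟨n, C, hf⟩ := hf
  obtain ⟨m, D, hg⟩ := hg
  exact ⟨max n m, C + D, (hf.mono_order (le_max_left _ _)).add (hg.mono_order (le_max_right _ _))⟩

/-- Integral linear substitutions preserve expansions. -/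
theorem HasExpansions.comp_linear [CompleteSpace O] [IsUltrametricDist O]
    {κ : Type*} [Fintype κ] {Y : Type*} {χ' : Y → κ → ℚ_[p]}
    (hf : HasExpansions F χ n C f) (A : ι → κ → ℚ_[p]) (hA : ∀ i j, ‖A i j‖ ≤ 1)
    (u : Y → X) (hu : ∀ y i, χ (u y) i = ∑ j, A i j * χ' y j) :
    HasExpansions F χ' n C (fun y => f (u y)) := by
  classical
  refine ⟨hf.1, fun x => ?_⟩
  obtain ⟨c, hc, hC, hs⟩ := hf.2 (u x)
  -- the form `(A z) ^ α`, as a polynomial with integral coefficients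
  let B : ι → κ → ℤ_[p] := fun i j => ⟨A i j, hA i j⟩
  let G : (ι →₀ ℕ) → MvPolynomial κ ℤ_[p] := fun α =>
    ∏ i, (∑ j, MvPolynomial.C (B i j) * MvPolynomial.X j) ^ α i
  let cf : (ι →₀ ℕ) → (κ →₀ ℕ) → ℤ_[p] := fun α β => (G α).coeff β
  have hG : ∀ α, (G α).IsHomogeneous (∑ i, α i) := fun α => by
    refine MvPolynomial.IsHomogeneous.prod _ _ _ fun i _ => ?_
    suffices h : (∑ j, MvPolynomial.C (B i j) * MvPolynomial.X j :
        MvPolynomial κ ℤ_[p]).IsHomogeneous 1 by simpa using h.pow (α i)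
    refine MvPolynomial.IsHomogeneous.sum _ _ _ fun j _ => ?_
    simpa using (MvPolynomial.isHomogeneous_C κ (B i j)).mul
      (MvPolynomial.isHomogeneous_X ℤ_[p] j)
  have hGeval : ∀ (z : κ → ℚ_[p]) α, ∑ β ∈ (G α).support,
      (cf α β : ℚ_[p]) * monom z β = monom (fun i => ∑ j, A i j * z j) α := fun z α => by
    have : MvPolynomial.eval₂ (PadicInt.Coe.ringHom (p := p)) z (G α)
        = monom (fun i => ∑ j, A i j * z j) α := by
      simp [G, MvPolynomial.eval₂_prod, MvPolynomial.eval₂_pow, MvPolynomial.eval₂_sum,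
        MvPolynomial.eval₂_mul, MvPolynomial.eval₂_C, MvPolynomial.eval₂_X, monom]
      rfl
    rw [← this, MvPolynomial.eval₂_eq']
    rfl
  have hGnorm : ∀ α β, ‖(cf α β : ℚ_[p])‖ ≤ 1 := fun α β => PadicInt.norm_le_one _
  have hG0 : ∀ α β, ∑ i, α i ≠ ∑ j, β j → cf α β = 0 := fun α β h => by
    by_contra h0
    have := hG α h0
    rw [Finsupp.weight_apply, Finsupp.sum_fintype _ _ (by simp)] at this
    simp at this
    exact h this.symm
  let S : ℕ → Finset (ι →₀ ℕ) := fun d => Finset.univ.finsuppAntidiag d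
  have hS : ∀ d α, α ∈ S d ↔ ∑ i, α i = d := fun d α => by simp [S, Finset.mem_finsuppAntidiag]
  let S' : ℕ → Finset (κ →₀ ℕ) := fun d => Finset.univ.finsuppAntidiag d
  have hS' : ∀ d α, α ∈ S' d ↔ ∑ i, α i = d := fun d α => by simp [S', Finset.mem_finsuppAntidiag]
  have hbd : ∀ α β (c : O), ‖algebraMap ℚ_[p] F (cf α β : ℚ_[p]) • c‖ ≤ ‖c‖ :=
    fun α β c => norm_algebraMap_smul_le (hGnorm α β) c
  refine ⟨fun β => ∑ α ∈ S (∑ j, β j), algebraMap ℚ_[p] F (cf α β : ℚ_[p]) • c α,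
    ?_, ?_, ?_⟩
  · rw [Metric.tendsto_nhds]
    intro ε hε
    have hfin : {α | ε / 2 < ‖c α‖}.Finite := by
      have := (Metric.tendsto_nhds.1 hc) (ε / 2) (by positivity)
      rw [eventually_cofinite] at this
      refine this.subset fun α hα => ?_
      simpa using le_of_lt hα
    refine Set.Finite.subset (s := ⋃ α ∈ {α | ε / 2 < ‖c α‖}, (S' (∑ i, α i) : Set (κ →₀ ℕ)))
      (hfin.biUnion fun α _ => Finset.finite_toSet _) fun β hβ => ?_
    by_contra hcon
    simp only [Set.mem_iUnion, not_exists, Finset.mem_coe, hS', Set.mem_ofPred_eq] at hcon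
    apply hβ
    simp only [Set.mem_ofPred_eq, dist_zero_right]
    refine lt_of_le_of_lt ?_ (half_lt_self hε)
    refine IsUltrametricDist.norm_sum_le_of_forall_le_of_nonneg (by positivity) fun α hα => ?_
    refine (hbd α β _).trans (not_lt.1 fun h => hcon α h ?_)
    exact ((hS _ _).1 hα).symm
  · intro β
    exact IsUltrametricDist.norm_sum_le_of_forall_le_of_nonneg hf.1
      fun α _ => (hbd α β _).trans (hC α)
  · intro z y hz hy
    have hz' : ∀ i, ‖∑ j, A i j * z j‖ ≤ 1 := fun i => by
      refine IsUltrametricDist.norm_sum_le_of_forall_le_of_nonneg zero_le_one fun j _ => ?_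
      rw [norm_mul]
      exact mul_le_one₀ (hA i j) (norm_nonneg _) (hz j)
    have h1 := hs (fun i => ∑ j, A i j * z j) (u y) hz' fun i => by
      rw [hu, hu, Finset.mul_sum, ← Finset.sum_add_distrib]
      refine Finset.sum_congr rfl fun j _ => ?_
      rw [hy]; ring
    let H : (ι →₀ ℕ) × (κ →₀ ℕ) → O := fun q =>
      algebraMap ℚ_[p] F ((cf q.1 q.2 : ℚ_[p]) * monom z q.2) • c q.1
    have hH : Tendsto H cofinite (𝓝 0) := by
      rw [Metric.tendsto_nhds]
      intro ε hε
      have hfin := (Metric.tendsto_nhds.1 hc) ε hε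
      rw [eventually_cofinite] at hfin
      refine Set.Finite.subset (s := ⋃ α ∈ {α | ¬ dist (c α) 0 < ε},
        ({α} ×ˢ (S' (∑ i, α i) : Set (κ →₀ ℕ))))
        (hfin.biUnion fun α _ => (Set.finite_singleton _).prod (Finset.finite_toSet _))
        fun q hq => ?_
      have hq0 : ¬ dist (H q) 0 < ε := hq
      simp only [Set.mem_iUnion, Set.mem_prod, Set.mem_singleton_iff, Finset.mem_coe, hS',
        Set.mem_ofPred_eq]
      refine ⟨q.1, ?_, rfl, ?_⟩
      · intro h
        apply hq0
        rw [dist_zero_right] at h ⊢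
        refine lt_of_le_of_lt (norm_algebraMap_smul_le ?_ _) h
        rw [norm_mul]
        exact mul_le_one₀ (hGnorm _ _) (norm_nonneg _) (norm_monom_le hz _)
      · by_contra h
        apply hq0
        simp only [H]
        rw [hG0 q.1 q.2 (fun h' => h h'.symm)]
        simpa using hε
    have hsum : Summable H := NonarchimedeanAddGroup.summable_of_tendsto_cofinite_zero hH
    have h2 : HasSum (fun α => algebraMap ℚ_[p] F (monom (fun i => ∑ j, A i j * z j) α) • c α)
        (∑' q, H q) := by
      refine hsum.hasSum.prod_fiberwise fun α => ?_
      rw [← hGeval, map_sum, Finset.sum_smul]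
      refine hasSum_sum_of_ne_finset_zero fun β hβ => ?_
      simp only [H]
      rw [show cf α β = 0 from MvPolynomial.notMem_support_iff.1 hβ]
      simp
    have h3 : ∑' q, H q = f (u y) := h2.unique h1
    have h4 : HasSum H (f (u y)) := h3 ▸ hsum.hasSum
    refine HasSum.prod_fiberwise (f := fun q : (κ →₀ ℕ) × (ι →₀ ℕ) => H q.swap)
      ((Equiv.prodComm _ _).hasSum_iff.2 h4) fun β => ?_
    have : algebraMap ℚ_[p] F (monom z β) • ∑ α ∈ S (∑ j, β j),
        algebraMap ℚ_[p] F (cf α β : ℚ_[p]) • c α = ∑ α ∈ S (∑ j, β j), H (α, β) := by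
      rw [Finset.smul_sum]
      refine Finset.sum_congr rfl fun α _ => ?_
      simp only [H]
      rw [smul_smul, ← map_mul, mul_comm]
    rw [this]
    refine hasSum_sum_of_ne_finset_zero fun α hα => ?_
    simp only [Prod.swap_prod_mk, H]
    rw [hG0 α β (fun h => hα ((hS _ _).2 h))]
    simp

end Analytic

/-! ### The semigroup `Σ₀(pℤ_p)`, the spaces `W`, and homogeneous distributions -/

section Distributions

variable (p : ℕ) [Fact p.Prime]

variable {p} in
theorem norm_comb_le {x y z w : ℚ_[p]} (hx : ‖x‖ ≤ 1) (hy : ‖y‖ ≤ 1) (hz : ‖z‖ ≤ 1)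
    (hw : ‖w‖ ≤ 1) : ‖x * y + z * w‖ ≤ 1 := by
  refine (IsUltrametricDist.norm_add_le_max _ _).trans (max_le ?_ ?_) <;> rw [norm_mul]
  · exact mul_le_one₀ hx (norm_nonneg _) hy
  · exact mul_le_one₀ hz (norm_nonneg _) hw

variable {p} in
theorem norm_comb_eq {x y z w : ℚ_[p]} (hx : ‖x‖ = 1) (hy : ‖y‖ = 1) (hz : ‖z‖ ≤ 1)
    (hw : ‖w‖ < 1) : ‖x * y + z * w‖ = 1 := by
  have h1 : ‖x * y‖ = 1 := by rw [norm_mul, hx, hy, one_mul]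
  have h2 : ‖z * w‖ < 1 := by
    rw [norm_mul]
    exact lt_of_le_of_lt (mul_le_of_le_one_left (norm_nonneg _) hz) hw
  rw [IsUltrametricDist.norm_add_eq_max_of_norm_ne_norm (by rw [h1]; exact h2.ne'), h1]
  exact max_eq_left h2.le

/-- The semigroup `Σ₀(pℤ_p)` of matrices `(a b; c d)` with entries in `ℤ_p`, non-zero determinant,
`a ∈ ℤ_pˣ` and `c ∈ pℤ_p`, inside `GL₂(ℚ_p)`. -/
def Sigma0 : Submonoid (GL (Fin 2) ℚ_[p]) where
  carrier := {g | (∀ i j, ‖g.1 i j‖ ≤ 1) ∧ ‖g.1 0 0‖ = 1 ∧ ‖g.1 1 0‖ < 1}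
  one_mem' := by
    refine ⟨fun i j => ?_, by simp, by simp⟩
    rw [Units.val_one, Matrix.one_apply]
    split_ifs <;> simp
  mul_mem' := by
    rintro g h ⟨hg, hga, hgc⟩ ⟨hh, hha, hhc⟩
    refine ⟨fun i j => ?_, ?_, ?_⟩ <;>
      rw [Units.val_mul, Matrix.mul_apply, Fin.sum_univ_two]
    · exact norm_comb_le (hg _ _) (hh _ _) (hg _ _) (hh _ _)
    · exact norm_comb_eq hga hha (hg _ _) hhc
    · refine lt_of_le_of_lt (IsUltrametricDist.norm_add_le_max _ _) (max_lt ?_ ?_) <;> rw [norm_mul]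
      · rwa [hha, mul_one]
      · exact lt_of_le_of_lt (mul_le_of_le_one_left (norm_nonneg _) (hg _ _)) hhc

/-- The group `Γ₀(pℤ_p) = Σ₀(pℤ_p) ∩ GL₂(ℤ_p)`. -/
def Gamma0 : Subgroup (GL (Fin 2) ℚ_[p]) where
  carrier := {g | g ∈ Sigma0 p ∧ ‖g.1.det‖ = 1}
  one_mem' := ⟨one_mem _, by simp⟩
  mul_mem' := by
    rintro g h ⟨hg, hg'⟩ ⟨hh, hh'⟩
    exact ⟨mul_mem hg hh, by rw [Units.val_mul, Matrix.det_mul, norm_mul, hg', hh', one_mul]⟩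
  inv_mem' := by
    rintro g ⟨⟨hg, hga, hgc⟩, hd⟩
    have hdet : ‖(g⁻¹).1.det‖ = 1 := by
      have h1 : ‖(g.1 * (g⁻¹).1).det‖ = 1 := by simp
      rwa [Matrix.det_mul, norm_mul, hd, one_mul] at h1
    have hinv : ∀ i j, ‖(g⁻¹).1 i j‖ = ‖g.1.adjugate i j‖ := fun i j => by
      rw [Matrix.coe_units_inv, Matrix.inv_def, Matrix.smul_apply, Ring.inverse_eq_inv', smul_eq_mul,
        norm_mul, norm_inv, hd, inv_one, one_mul]
    have hdd : ‖g.1 1 1‖ = 1 := by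
      refine le_antisymm (hg _ _) (not_lt.1 fun hlt => ?_)
      have h3 : ‖g.1.det‖ < 1 := by
        rw [Matrix.det_fin_two, sub_eq_add_neg]
        refine lt_of_le_of_lt (IsUltrametricDist.norm_add_le_max _ _) (max_lt ?_ ?_)
        · rwa [norm_mul, hga, one_mul]
        · rw [norm_neg, norm_mul]
          exact lt_of_le_of_lt (mul_le_of_le_one_left (norm_nonneg _) (hg _ _)) hgc
      exact absurd hd h3.ne
    refine ⟨⟨fun i j => ?_, ?_, ?_⟩, hdet⟩ <;> rw [hinv, Matrix.adjugate_fin_two]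
    · fin_cases i <;> fin_cases j <;> simp [hg]
    · simpa using hdd
    · simpa using hgc

variable (R : Type*) [Fintype R]

/-- `W ^ R`, for `W = ℤ_pˣ × ℤ_p`.  A point of `(ℚ_p ^ 2) ^ R` is written as a matrix with two
columns whose rows, indexed by `R`, are the components of the point.  So `W` itself is
`W p Unit`, and `W × W` is `W p (Fin 2)`, viewed inside the `2 × 2` matrices. -/
def W : Set (Matrix R (Fin 2) ℚ_[p]) := {w | ∀ r, ‖w r 0‖ = 1 ∧ ‖w r 1‖ ≤ 1}

/-- `(W × W)₀`, the locus in `W × W` where the determinant is a `p`-adic unit. -/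
def WW0 : Set (Matrix (Fin 2) (Fin 2) ℚ_[p]) := {w | w ∈ W p (Fin 2) ∧ ‖w.det‖ = 1}

variable {p R}

/-- The embedding in affine space. -/
def chart (X : Set (Matrix R (Fin 2) ℚ_[p])) (w : X) (i : R × Fin 2) : ℚ_[p] := w.1 i.1 i.2

/-- The right action of `Σ₀(pℤ_p)` on `W ^ R`, through row vectors. -/
def actW (g : Sigma0 p) (w : W p R) : W p R :=
  ⟨w.1 * g.1.1, fun r => by
    obtain ⟨hg, hga, hgc⟩ := g.2
    rw [Matrix.mul_apply, Matrix.mul_apply, Fin.sum_univ_two, Fin.sum_univ_two]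
    exact ⟨norm_comb_eq (w.2 r).1 hga (w.2 r).2 hgc,
      norm_comb_le (w.2 r).1.le (hg _ _) (w.2 r).2 (hg _ _)⟩⟩

variable (F : Type*) [NormedField F] [NormedAlgebra ℚ_[p] F]
  {O : Type*} [NormedCommRing O] [NormedAlgebra F O]

/-- `𝒜_κ(X)`: the locally analytic functions `f : X → O` with `f (t w) = κ(t) f(w)`, where the
torus `T ^ R`, `T = ℤ_pˣ`, acts on `X ⊆ (ℚ_p ^ 2) ^ R` by scaling the components. -/
def HomFun (X : Set (Matrix R (Fin 2) ℚ_[p])) (κ : (R → ℤ_[p]ˣ) →* Oˣ) : Submodule O (X → O) where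
  carrier := {f | IsLocAnalytic F (chart X) f ∧ ∀ (t : R → ℤ_[p]ˣ) (w w' : X),
    (∀ r j, w'.1 r j = ((t r : ℤ_[p]) : ℚ_[p]) * w.1 r j) → f w' = κ t * f w}
  zero_mem' := ⟨⟨0, 0, HasExpansions.zero _⟩, fun _ _ _ _ => by simp⟩
  add_mem' := by
    rintro f g ⟨hf, hf'⟩ ⟨hg, hg'⟩
    exact ⟨hf.add hg, fun t w w' h => by
      rw [Pi.add_apply, Pi.add_apply, hf' t w w' h, hg' t w w' h, mul_add]⟩
  smul_mem' := by
    rintro a f ⟨⟨n, C, hf⟩, hf'⟩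
    exact ⟨⟨n, _, hf.smul a⟩, fun t w w' h => by
      rw [Pi.smul_apply, Pi.smul_apply, hf' t w w' h, smul_eq_mul, smul_eq_mul, mul_left_comm]⟩

/-- The homogeneous distributions on the compact manifold `X`: the continuous `O`-linear
functionals on `𝒜_κ(X)`.  As the locally analytic functions carry the inductive limit topology
over the orders `n` of expansions, continuity means boundedness on the functions of each order.
`W`, `W × W` and `(W × W)₀` are trivial bundles for their tori, so for them this dual
is canonically the module `O ⊗̂_κ 𝒟(X)` over the algebra of distributions on the torus. -/
def Distr (X : Set (Matrix R (Fin 2) ℚ_[p])) (κ : (R → ℤ_[p]ˣ) →* Oˣ) :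
    Submodule O (HomFun F X κ →ₗ[O] O) where
  carrier := {μ | ∀ n : ℕ, ∃ M : ℝ, ∀ (f : HomFun F X κ) (C : ℝ),
    HasExpansions F (chart X) n C f.1 → ‖μ f‖ ≤ M * C}
  zero_mem' := fun n => ⟨0, fun f C _ => by simp⟩
  add_mem' := by
    intro μ ν hμ hν n
    obtain ⟨M, hM⟩ := hμ n
    obtain ⟨N, hN⟩ := hν n
    refine ⟨M + N, fun f C hf => (norm_add_le _ _).trans ?_⟩
    rw [add_mul]
    exact add_le_add (hM f C hf) (hN f C hf)
  smul_mem' := by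
    intro a μ hμ n
    obtain ⟨M, hM⟩ := hμ n
    refine ⟨‖a‖ * M, fun f C hf => (norm_mul_le _ _).trans ?_⟩
    rw [mul_assoc]
    exact mul_le_mul_of_nonneg_left (hM f C hf) (norm_nonneg _)

variable {F} {κ : (R → ℤ_[p]ˣ) →* Oˣ}

theorem HasExpansions.comp_actW [CompleteSpace O] [IsUltrametricDist O] {n : ℕ} {C : ℝ}
    {f : W p R → O} (hf : HasExpansions F (chart (W p R)) n C f) (g : Sigma0 p) :
    HasExpansions F (chart (W p R)) n C (fun w => f (actW g w)) := by
  classical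
  refine hf.comp_linear (fun i j => if j.1 = i.1 then g.1.1 j.2 i.2 else 0) (fun i j => ?_)
    (actW g) fun w i => ?_
  · split_ifs
    · exact g.2.1 _ _
    · simp
  · rw [Fintype.sum_prod_type, Finset.sum_eq_single i.1]
    · simp only [chart, actW, Matrix.mul_apply, if_true]
      exact Finset.sum_congr rfl fun _ _ => mul_comm _ _
    · intro r _ hr
      simp [hr]
    · simp

/-- The action of `g ∈ Σ₀(pℤ_p)` on `𝒜_κ(W ^ R)`: `f ↦ (w ↦ f (w g))`. -/
def pull [CompleteSpace O] [IsUltrametricDist O] (g : Sigma0 p) :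
    HomFun F (W p R) κ →ₗ[O] HomFun F (W p R) κ where
  toFun f := ⟨fun w => f.1 (actW g w), by
    obtain ⟨⟨n, C, hf⟩, hf'⟩ := f.2
    refine ⟨⟨n, C, hf.comp_actW g⟩, fun t w w' h => hf' t _ _ fun r j => ?_⟩
    simp only [actW, Matrix.mul_apply, Fin.sum_univ_two, h]
    ring⟩
  map_add' _ _ := rfl
  map_smul' _ _ := rfl

/-- The right action of `Σ₀(pℤ_p)` on distributions: `(μ g)(f) = μ (w ↦ f (w g))`. -/
def actD [CompleteSpace O] [IsUltrametricDist O] (μ : Distr F (W p R) κ) (g : Sigma0 p) :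
    Distr F (W p R) κ :=
  ⟨μ.1 ∘ₗ pull g, fun n => by
    obtain ⟨M, hM⟩ := μ.2 n
    exact ⟨M, fun f C hf => hM _ C (hf.comp_actW g)⟩⟩

/-! #### Restriction to `(W × W)₀` -/

variable {κ : (Fin 2 → ℤ_[p]ˣ) →* Oˣ}

/-- Restriction of functions from `W × W` to `(W × W)₀`. -/
def resFun : HomFun F (W p (Fin 2)) κ →ₗ[O] HomFun F (WW0 p) κ where
  toFun f := ⟨fun w => f.1 ⟨w.1, w.2.1⟩, by
    obtain ⟨⟨n, C, hf⟩, hf'⟩ := f.2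
    refine ⟨⟨n, C, hf.1, fun x => ?_⟩, fun t w w' h => hf' t _ _ h⟩
    obtain ⟨c, hc, hC, hs⟩ := hf.2 ⟨x.1, x.2.1⟩
    exact ⟨c, hc, hC, fun z y hz hy => hs z ⟨y.1, y.2.1⟩ hz hy⟩⟩
  map_add' _ _ := rfl
  map_smul' _ _ := rfl

open Classical in
/-- Extension by zero of a function on `(W × W)₀`. -/
def extZero (f : WW0 p → O) (w : W p (Fin 2)) : O :=
  if h : ‖w.1.det‖ = 1 then f ⟨w.1, w.2, h⟩ else 0

theorem norm_det_eq_one_of_congr {n : ℕ} (hn : 1 ≤ n) {x y : W p (Fin 2)}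
    {z : Fin 2 × Fin 2 → ℚ_[p]} (hz : ∀ i, ‖z i‖ ≤ 1)
    (hy : ∀ i, chart _ y i = chart _ x i + (p : ℚ_[p]) ^ n * z i) (hx : ‖x.1.det‖ = 1) :
    ‖y.1.det‖ = 1 := by
  have hp : ‖(p : ℚ_[p]) ^ n‖ < 1 := by
    rw [norm_pow]
    exact pow_lt_one₀ (norm_nonneg _) Padic.norm_p_lt_one (by omega)
  have hint : ∀ (w : W p (Fin 2)) i j, ‖w.1 i j‖ ≤ 1 := fun w i j => by
    fin_cases j
    · exact (w.2 i).1.le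
    · exact (w.2 i).2
  have hy' : ∀ i j, y.1 i j = x.1 i j + (p : ℚ_[p]) ^ n * z (i, j) := fun i j => hy (i, j)
  have key : y.1.det = x.1.det + ((z (0, 0) * y.1 1 1 + x.1 0 0 * z (1, 1)) * 1 +
      (-1) * (z (0, 1) * y.1 1 0 + x.1 0 1 * z (1, 0))) * (p : ℚ_[p]) ^ n := by
    rw [Matrix.det_fin_two, Matrix.det_fin_two, hy' 0 0, hy' 0 1, hy' 1 1, hy' 1 0]
    ring
  have hx1 : ‖x.1.det‖ = ‖x.1.det * 1 + ((z (0, 0) * y.1 1 1 + x.1 0 0 * z (1, 1)) * 1 +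
      (-1) * (z (0, 1) * y.1 1 0 + x.1 0 1 * z (1, 0))) * (p : ℚ_[p]) ^ n‖ := by
    rw [hx]
    symm
    refine norm_comb_eq hx (by simp) (norm_comb_le ?_ (by simp) (by simp) ?_) hp
    · exact norm_comb_le (hz _) (hint _ _ _) (hint _ _ _) (hz _)
    · exact norm_comb_le (hz _) (hint _ _ _) (hint _ _ _) (hz _)
  rw [key, ← hx, hx1, mul_one (Matrix.det x.1)]

theorem HasExpansions.extZero {n : ℕ} {C : ℝ} {f : WW0 p → O}
    (hf : HasExpansions F (chart (WW0 p)) n C f) :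
    HasExpansions F (chart (W p (Fin 2))) (max n 1) C (extZero f) := by
  have hn : 1 ≤ max n 1 := le_max_right _ _
  replace hf := hf.mono_order (le_max_left n 1)
  refine ⟨hf.1, fun x => ?_⟩
  by_cases hx : ‖x.1.det‖ = 1
  · obtain ⟨c, hc, hC, hs⟩ := hf.2 ⟨x.1, x.2, hx⟩
    refine ⟨c, hc, hC, fun z y hz hy => ?_⟩
    have hy1 := norm_det_eq_one_of_congr hn hz hy hx
    rw [QuatForms.extZero, dif_pos hy1]
    exact hs z ⟨y.1, y.2, hy1⟩ hz hy
  · refine ⟨0, tendsto_const_nhds, fun _ => by simpa using hf.1, fun z y hz hy => ?_⟩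
    have hy1 : ‖y.1.det‖ ≠ 1 := fun h => hx <|
      norm_det_eq_one_of_congr hn (z := -z) (fun i => by simpa using hz i)
        (fun i => by rw [hy i, Pi.neg_apply]; ring) h
    rw [QuatForms.extZero, dif_neg hy1]
    simp

/-- Extension by zero, from `𝒜_κ((W × W)₀)` to `𝒜_κ(W × W)`. -/
def extFun : HomFun F (WW0 p) κ →ₗ[O] HomFun F (W p (Fin 2)) κ where
  toFun f := ⟨extZero f.1, by
    obtain ⟨⟨n, C, hf⟩, hf'⟩ := f.2
    refine ⟨⟨_, C, hf.extZero⟩, fun t w w' h => ?_⟩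
    have hdet : ‖w'.1.det‖ = ‖w.1.det‖ := by
      have : w'.1.det = (((t 0 : ℤ_[p]) : ℚ_[p]) * ((t 1 : ℤ_[p]) : ℚ_[p])) * w.1.det := by
        rw [Matrix.det_fin_two, Matrix.det_fin_two]
        simp only [h]
        ring
      have hu : ∀ u : ℤ_[p]ˣ, ‖((u : ℤ_[p]) : ℚ_[p])‖ = 1 := fun u => PadicInt.norm_units u
      rw [this, norm_mul, norm_mul, hu, hu, one_mul, one_mul]
    by_cases hw : ‖w.1.det‖ = 1
    · rw [extZero, extZero, dif_pos hw, dif_pos (hdet.trans hw)]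
      exact hf' t _ _ h
    · rw [extZero, extZero, dif_neg hw, dif_neg (by rwa [hdet]), mul_zero]⟩
  map_add' f g := by
    ext w
    change extZero (f.1 + g.1) w = extZero f.1 w + extZero g.1 w
    unfold extZero
    split_ifs <;> simp
  map_smul' a f := by
    ext w
    change extZero (a • f.1) w = a • extZero f.1 w
    unfold extZero
    split_ifs <;> simp

/-- `μ ↦ μ⁰`, from distributions on `W × W` to distributions on `(W × W)₀`: the dual of
extension by zero. -/
def res0 (μ : Distr F (W p (Fin 2)) κ) : Distr F (WW0 p) κ :=
  ⟨μ.1 ∘ₗ extFun, fun n => by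
    obtain ⟨M, hM⟩ := μ.2 (max n 1)
    exact ⟨M, fun f C hf => hM _ C hf.extZero⟩⟩

/-- `i_*`, the push-forward of distributions along the inclusion of `(W × W)₀` in `W × W`. -/
def push0 (μ : Distr F (WW0 p) κ) : Distr F (W p (Fin 2)) κ :=
  ⟨μ.1 ∘ₗ resFun, fun n => by
    obtain ⟨M, hM⟩ := μ.2 n
    refine ⟨M, fun f C hf => hM _ C ⟨hf.1, fun x => ?_⟩⟩
    obtain ⟨c, hc, hC, hs⟩ := hf.2 ⟨x.1, x.2.1⟩
    exact ⟨c, hc, hC, fun z y hz hy => hs z ⟨y.1, y.2.1⟩ hz hy⟩⟩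

/-! #### Weights and products of distributions -/

/-- The embedding of `T = ℤ_pˣ` in the affine line. -/
def chartT (t : ℤ_[p]ˣ) (_ : Unit) : ℚ_[p] := ((t : ℤ_[p]) : ℚ_[p])

variable (F) in
/-- An `O`-weight: a locally analytic character `k : ℤ_pˣ → Oˣ`. -/
structure Weight (O : Type*) [NormedCommRing O] [NormedAlgebra F O] where
  /-- the character -/
  char : ℤ_[p]ˣ →* Oˣ
  /-- it is locally analytic -/
  analytic : IsLocAnalytic F chartT (fun t => (char t : O))

/-- A weight as a character of `T ^ Unit`, acting on `W`. -/
def Weight.single (k : Weight (p := p) F O) : (Unit → ℤ_[p]ˣ) →* Oˣ :=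
  k.char.comp (Pi.evalMonoidHom _ ())

variable {O₁ O₂ : Type*} [NormedCommRing O₁] [NormedAlgebra F O₁]
  [NormedCommRing O₂] [NormedAlgebra F O₂]

/-- The weight `k₁ ⊞ k₂ : T × T → (O₁ ⊗̂ O₂)ˣ`, `(t₁, t₂) ↦ k₁(t₁) ⊗ k₂(t₂)`. -/
def boxplus (k₁ : Weight (p := p) F O₁) (k₂ : Weight (p := p) F O₂) :
    (Fin 2 → ℤ_[p]ˣ) →* (CTensor F O₁ O₂)ˣ :=
  ((Units.map (inl F O₁ O₂).toMonoidHom).comp (k₁.char.comp (Pi.evalMonoidHom _ 0))) *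
    ((Units.map (inr F O₁ O₂).toMonoidHom).comp (k₂.char.comp (Pi.evalMonoidHom _ 1)))

/-- The component of index `r` of a point of `W × W`. -/
def component (r : Fin 2) (w : W p (Fin 2)) : W p Unit := ⟨fun _ j => w.1 r j, fun _ => w.2 r⟩

/-- `μ` is the product `μ₁ ⊗ μ₂` of two distributions on `W`, as a distribution on `W × W`:
`μ(f₁ ⊗ f₂) = μ₁(f₁) ⊗ μ₂(f₂)` for all `f₁`, `f₂`, where `(f₁ ⊗ f₂)(w₁, w₂) = f₁(w₁) ⊗ f₂(w₂)`. -/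
def IsProduct {k₁ : Weight (p := p) F O₁} {k₂ : Weight (p := p) F O₂}
    (μ₁ : Distr F (W p Unit) k₁.single) (μ₂ : Distr F (W p Unit) k₂.single)
    (μ : Distr F (W p (Fin 2)) (boxplus k₁ k₂)) : Prop :=
  ∀ (f₁ : HomFun F (W p Unit) k₁.single) (f₂ : HomFun F (W p Unit) k₂.single)
    (f : HomFun F (W p (Fin 2)) (boxplus k₁ k₂)),
    (∀ w, f.1 w = inl F O₁ O₂ (f₁.1 (component 0 w)) * inr F O₁ O₂ (f₂.1 (component 1 w))) →
      μ.1 f = inl F O₁ O₂ (μ₁.1 f₁) * inr F O₁ O₂ (μ₂.1 f₂)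

end Distributions

/-! ### `p`-adic modular forms on a definite quaternion algebra -/

section Forms

/-- The map of quaternion algebras induced by a map of the base rings. -/
def quatMap {R S : Type*} [CommRing R] [CommRing S] (φ : R →+* S) (a b : R) :
    ℍ[R, a, b] →+* ℍ[S, φ a, φ b] where
  toFun x := ⟨φ x.re, φ x.imI, φ x.imJ, φ x.imK⟩
  map_one' := by ext <;> simp
  map_zero' := by ext <;> simp
  map_add' x y := by ext <;> simp
  map_mul' x y := by ext <;> simp

instance (l : Nat.Primes) : Fact (l : ℕ).Prime := ⟨l.2⟩

variable (p : ℕ) [Fact p.Prime]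

/-- `𝔸_f^p`, the finite adeles of `ℚ` away from `p`: the restricted product of the `ℚ_ℓ` with
respect to the `ℤ_ℓ`, over the primes `ℓ ≠ p`. -/
abbrev AdelesAway : Type :=
  RestrictedProduct (fun l : {l : Nat.Primes // (l : ℕ) ≠ p} => ℚ_[(l.1 : ℕ)])
    (fun l => PadicInt.subring (l.1 : ℕ)) cofinite

/-- The diagonal embedding of `ℚ` in `𝔸_f^p`. -/
def ratToAdeles : ℚ →+* AdelesAway p where
  toFun q := ⟨fun l => (q : ℚ_[(l.1 : ℕ)]), by
    rw [eventually_cofinite]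
    have hinj : Function.Injective (fun l : {l : Nat.Primes // (l : ℕ) ≠ p} => (l.1 : ℕ)) :=
      fun a b h => Subtype.ext (Subtype.ext h)
    refine Set.Finite.subset (Set.Finite.preimage hinj.injOn q.den.primeFactors.finite_toSet)
      fun l hl => ?_
    simp only [Set.mem_preimage, Finset.mem_coe, Nat.mem_primeFactors]
    refine ⟨l.1.2, ?_, q.den_nz⟩
    by_contra h
    exact hl (Padic.norm_rat_le_one h)⟩
  map_one' := by ext; simp
  map_zero' := by ext; simp
  map_add' x y := by ext l; exact Rat.cast_add x y
  map_mul' x y := by ext l; exact Rat.cast_mul x y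

variable (a b : ℚ)

/-- `B ⊗ 𝔸_f^p`, for the quaternion algebra `B = (a, b)` over `ℚ`. -/
abbrev BAway : Type := ℍ[AdelesAway p, ratToAdeles p a, ratToAdeles p b]

/-- `B ⊗ 𝔸_f^p` has the topology of the free `𝔸_f^p`-module of rank four. -/
instance : TopologicalSpace (BAway p a b) :=
  TopologicalSpace.induced (fun x => ((x.re, x.imI), (x.imJ, x.imK))) inferInstance

/-- The group `B_f^× = B_f^{×,p} × B_p^×`, where `B_p^×` is identified with `GL₂(ℚ_p)`. -/
abbrev Bf : Type := (BAway p a b)ˣ × GL (Fin 2) ℚ_[p]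

/-- `B_p = B ⊗ ℚ_p`. -/
abbrev Bp : Type := ℍ[ℚ_[p], algebraMap ℚ ℚ_[p] a, algebraMap ℚ ℚ_[p] b]

variable {p a b}

/-- The diagonal embedding of `B^×` in `B_f^×`, for a given splitting of `B` at `p`. -/
def diag (ψ : Bp p a b ≃ₐ[ℚ_[p]] Matrix (Fin 2) (Fin 2) ℚ_[p]) : (ℍ[ℚ, a, b])ˣ →* Bf p a b :=
  (Units.map (quatMap (ratToAdeles p) a b).toMonoidHom).prod
    (Units.map (((ψ : Bp p a b →* Matrix (Fin 2) (Fin 2) ℚ_[p])).comp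
      (quatMap (algebraMap ℚ ℚ_[p]) a b).toMonoidHom))

variable (p a b) in
/-- The semigroup `Σ_p(B_f^×) = B_f^{×,p} × Σ₀(pℤ_p)`. -/
def SigmaBf : Submonoid (Bf p a b) := (⊤ : Submonoid (BAway p a b)ˣ).prod (Sigma0 p)

/-- The open compact subgroup `K^p Γ₀(pℤ_p)`. -/
def level (Kp : Subgroup (BAway p a b)ˣ) : Subgroup (Bf p a b) := Kp.prod (Gamma0 p)

theorem level_le (Kp : Subgroup (BAway p a b)ˣ) {u : Bf p a b} (hu : u ∈ level Kp) :
    u ∈ SigmaBf p a b :=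
  ⟨trivial, hu.2.1⟩

variable {F : Type*} [NormedField F] [NormedAlgebra ℚ_[p] F]
  {O : Type*} [NormedCommRing O] [NormedAlgebra F O] [CompleteSpace O] [IsUltrametricDist O]
  {R : Type*} [Fintype R] {κ : (R → ℤ_[p]ˣ) →* Oˣ}

/-- The right action of `Σ_p(B_f^×)` on functions `φ : B_f^× → 𝒟_κ(W ^ R)`:
`(φ u)(x) = φ(u x) u_p`. -/
def slash (φ : Bf p a b → Distr F (W p R) κ) (u : SigmaBf p a b) : Bf p a b → Distr F (W p R) κ :=
  fun x => actD (φ (u.1 * x)) ⟨u.1.2, u.2.2⟩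

/-- `φ` is fixed by `K^p Γ₀(pℤ_p)`. -/
def IsFixed (φ : Bf p a b → Distr F (W p R) κ) (Kp : Subgroup (BAway p a b)ˣ) : Prop :=
  ∀ (u : Bf p a b) (hu : u ∈ level Kp), slash φ ⟨u, level_le Kp hu⟩ = φ

/-- `φ` belongs to `M_p(𝒟_κ(W ^ R))^{Γ₀(pℤ_p)}`: it is right invariant under `B^×`, and fixed by
`K^p Γ₀(pℤ_p)` for some open and compact subgroup `K^p` of `B_f^{×,p}`. -/
def IsForm (ψ : Bp p a b ≃ₐ[ℚ_[p]] Matrix (Fin 2) (Fin 2) ℚ_[p])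
    (φ : Bf p a b → Distr F (W p R) κ) : Prop :=
  (∀ x γ, φ (x * diag ψ γ) = φ x) ∧
    ∃ Kp : Subgroup (BAway p a b)ˣ, IsOpen (Kp : Set (BAway p a b)ˣ) ∧
      IsCompact (Kp : Set (BAway p a b)ˣ) ∧ IsFixed φ Kp

/-- The set `K \ K π K` of right cosets `K x`, `x ∈ K π K`. -/
def Cosets (K : Subgroup (Bf p a b)) (π : Bf p a b) : Type :=
  {c : Quotient (QuotientGroup.rightRel K) //
    ∃ y ∈ DoubleCoset.doubleCoset π (K : Set (Bf p a b)) K, Quotient.mk _ y = c}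

/-- A representative, in `K π K`, of a coset in `K \ K π K`. -/
def Cosets.rep {K : Subgroup (Bf p a b)} {π : Bf p a b} (c : Cosets K π) : Bf p a b :=
  c.2.choose

theorem Cosets.rep_mem {Kp : Subgroup (BAway p a b)ˣ} {π : Bf p a b} (hπ : π ∈ SigmaBf p a b)
    (c : Cosets (level Kp) π) : c.rep ∈ SigmaBf p a b := by
  obtain ⟨x, hx, y, hy, h⟩ := DoubleCoset.mem_doubleCoset.1 c.2.choose_spec.1
  rw [Cosets.rep, h]
  exact mul_mem (mul_mem (level_le Kp hx) hπ) (level_le Kp hy)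

/-- The Hecke operator `φ | [K π K] = ∑_{x ∈ K \ K π K} φ x`, for `K = K^p Γ₀(pℤ_p)`. -/
def hecke (Kp : Subgroup (BAway p a b)ˣ) {π : Bf p a b} (hπ : π ∈ SigmaBf p a b)
    (φ : Bf p a b → Distr F (W p R) κ) : Bf p a b → Distr F (W p R) κ :=
  ∑ᶠ c : Cosets (level Kp) π, slash φ ⟨c.rep, c.rep_mem hπ⟩

variable (p a b) in
/-- The element of `B_f^×` concentrated at `p`, where it is the matrix `(1 0; 0 p)`. -/
def piHat : Bf p a b :=
  (1, Matrix.GeneralLinearGroup.mkOfDetNeZero !![1, 0; 0, (p : ℚ_[p])]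
    (by simpa [Matrix.det_fin_two] using (Fact.out : p.Prime).ne_zero))

theorem piHat_mem : piHat p a b ∈ SigmaBf p a b := by
  have h : ∀ i j, (piHat p a b).2.1 i j = !![1, 0; 0, (p : ℚ_[p])] i j := fun i j => rfl
  refine ⟨trivial, fun i j => ?_, ?_, ?_⟩ <;> rw [h]
  · fin_cases i <;> fin_cases j
    · simp
    · simp
    · simp
    · exact (Padic.norm_p_lt_one (p := p)).le
  · simp
  · simp

open Classical in
/-- The operator `U_p`, given by the double coset `K π̂_p K` for any `K = K^p Γ₀(pℤ_p)` fixing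
`φ` with `K^p` open and compact (the result does not depend on the choice of `K^p`). -/
def Up (φ : Bf p a b → Distr F (W p R) κ) : Bf p a b → Distr F (W p R) κ :=
  if h : ∃ Kp : Subgroup (BAway p a b)ˣ, IsOpen (Kp : Set (BAway p a b)ˣ) ∧
      IsCompact (Kp : Set (BAway p a b)ˣ) ∧ IsFixed φ Kp
  then hecke h.choose piHat_mem φ else 0

end Forms

end QuatForms

end

open scoped Quaternion
open QuatForms

open scoped TensorProduct Topology
open Filter

noncomputable section

namespace QuatForms

/-! ### Power series on the closed unit polydisc -/

section Tate

/-! The proof has an analytic half, the construction of `μ₁ ⊗ μ₂`, and an arithmetic half, the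
computation of `U_p`.

Analytic half. Every point of `W ^ R` is a unique torus multiple of a point of the section `y ↦ (1,
y)`, so homogeneous functions on `W ^ R` are the same as functions on `ℤ_p ^ R`, with control of
orders and norms (`HasExpansions.comp_slice`, `HasExpansions.extendHom`). A function on `ℤ_p ^ R` of
order `n` is a series in the monomials `polyBallPow n q` supported on residue classes modulo `p ^
n`, with coefficients tending to zero; in two variables these coefficients are shown to be unique
(`IsExpansion.eq_zero`). A distribution is bounded on each order, hence is computed termwise from
its values at the monomials (`Distr.hasSum`). Each monomial in two variables is a product of
monomials in one variable, so the values of `μ₁ ⊗ μ₂` there are forced; conversely these values are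
bounded and define a functional on each order. The functionals for different `n` agree
(`IsValue.mono_order`), which gives existence, and `isProduct_iff` adds uniqueness. Identities
between product distributions are then checked on pure tensors.

Arithmetic half. The cosets of `U_p` are represented by `u_j = (1 j; 0 p)`, `0 ≤ j < p`. Multiplying
the two eigenvalue equations gives `a₁a₂ (φ₁ ⊗ φ₂)(x) = ∑_{i,j} (φ₁(u_i x) ⊗ φ₂(u_j x)) (u_i, u_j)`,
while `U_p` of the product is the sum of the diagonal terms alone. If `w₁`, `w₂` have first
coordinates `x₁`, `x₂`, the determinant of `(w₁ u_i, w₂ u_j)` is congruent to `x₁ x₂ (j - i)` modulo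
`p`. So the terms with `i ≠ j` live on `(W × W)₀` and those with `i = j` on its complement, and `μ ↦
μ - i_* μ⁰` keeps exactly the diagonal (`norm_det_actRows_heckeElt`, `actDRows_heckeElt_apply`). -/

theorem tendsto_cofinite_zero_iff {E J : Type*} [SeminormedAddCommGroup E] {c : J → E} :
    Tendsto c cofinite (𝓝 0) ↔ ∀ ε > 0, {j | ε ≤ ‖c j‖}.Finite := by
  rw [Metric.tendsto_nhds]
  refine forall_congr' fun ε => imp_congr_right fun _ => ?_
  rw [eventually_cofinite]
  simp only [dist_zero_right, not_lt]

theorem exists_norm_le_of_tendsto_zero {E J : Type*} [SeminormedAddCommGroup E] {c : J → E}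
    (hc : Tendsto c cofinite (𝓝 0)) : ∃ C, ∀ j, ‖c j‖ ≤ C := by
  obtain ⟨C, hC⟩ := ((tendsto_cofinite_zero_iff.1 hc 1 one_pos).image fun j => ‖c j‖).bddAbove
  refine ⟨max C 1, fun j => ?_⟩
  rcases le_or_gt 1 ‖c j‖ with hj | hj
  · exact le_max_of_le_left (hC ⟨j, hj, rfl⟩)
  · exact le_max_of_le_right hj.le

theorem norm_le_of_hasSum {E J : Type*} [NormedAddCommGroup E] [IsUltrametricDist E]
    {f : J → E} {a : E} (h : HasSum f a) {C : ℝ} (hC : 0 ≤ C) (hf : ∀ j, ‖f j‖ ≤ C) : ‖a‖ ≤ C :=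
  le_of_tendsto h.norm (Eventually.of_forall fun _ =>
    IsUltrametricDist.norm_sum_le_of_forall_le_of_nonneg hC fun j _ => hf j)

/-- A double family with `‖f k j‖ ≤ C k → 0` such that `f k j → 0` along `j` for every `k`
tends to zero. -/
theorem tendsto_cofinite_prod_zero {E K J : Type*} [SeminormedAddCommGroup E] {f : K × J → E}
    {C : K → ℝ} (hC : Tendsto C cofinite (𝓝 0)) (hf : ∀ k j, ‖f (k, j)‖ ≤ C k)
    (h : ∀ k, Tendsto (fun j => f (k, j)) cofinite (𝓝 0)) : Tendsto f cofinite (𝓝 0) := by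
  rw [tendsto_cofinite_zero_iff] at hC ⊢
  intro ε hε
  refine Set.Finite.subset ((hC ε hε).biUnion fun k _ =>
    (Set.finite_singleton k).prod (tendsto_cofinite_zero_iff.1 (h k) ε hε)) ?_
  rintro ⟨k, j⟩ hkj
  simp only [Set.mem_iUnion, Set.mem_prod, Set.mem_singleton_iff]
  exact ⟨k, (show ε ≤ ‖f (k, j)‖ from hkj).trans ((hf k j).trans (le_abs_self _)), rfl, hkj⟩

variable {p : ℕ} [Fact p.Prime] {ι κ K : Type*} [Fintype ι] [Fintype κ]

variable (F : Type*) [NormedField F] [NormedAlgebra ℚ_[p] F]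
  {O : Type*} [NormedCommRing O] [NormedAlgebra F O]

/-- On the closed unit polydisc of `ℚ_p ^ ι`, the function `f` is given by a power series whose
coefficients tend to zero and have norm at most `C`. -/
def HasTate (C : ℝ) (f : (ι → ℚ_[p]) → O) : Prop :=
  ∃ c : (ι →₀ ℕ) → O, Tendsto c cofinite (𝓝 0) ∧ (∀ α, ‖c α‖ ≤ C) ∧
    ∀ z : ι → ℚ_[p], (∀ i, ‖z i‖ ≤ 1) →
      HasSum (fun α => algebraMap ℚ_[p] F (monom z α) • c α) (f z)

variable {F} {C D : ℝ} {f g : (ι → ℚ_[p]) → O}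

theorem HasTate.congr (hf : HasTate F C f) (h : ∀ z, (∀ i, ‖z i‖ ≤ 1) → f z = g z) :
    HasTate F C g := by
  obtain ⟨c, hc, hC, hs⟩ := hf
  exact ⟨c, hc, hC, fun z hz => h z hz ▸ hs z hz⟩

theorem HasTate.mono (hf : HasTate F C f) (h : C ≤ D) : HasTate F D f := by
  obtain ⟨c, hc, hC, hs⟩ := hf
  exact ⟨c, hc, fun α => (hC α).trans h, hs⟩

theorem HasTate.nonneg (hf : HasTate F C f) : 0 ≤ C := by
  obtain ⟨c, _, hC, _⟩ := hf
  exact (norm_nonneg _).trans (hC 0)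

theorem HasTate.norm_le [IsUltrametricDist O] (hf : HasTate F C f) {z : ι → ℚ_[p]}
    (hz : ∀ i, ‖z i‖ ≤ 1) : ‖f z‖ ≤ C := by
  have h0 := hf.nonneg
  obtain ⟨c, _, hC, hs⟩ := hf
  exact norm_le_of_hasSum (hs z hz) h0
    fun α => (norm_algebraMap_smul_le (norm_monom_le hz α) _).trans (hC α)

/-- The double family of coefficients tends to zero, so in a complete ultrametric ring it may be
summed in either order: by rows it gives `g`, by columns a power series. Sums, products,
substitutions and geometric series below are all instances. -/
theorem hasTate_of_hasSum [CompleteSpace O] [IsUltrametricDist O] {f : K → (ι → ℚ_[p]) → O}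
    {C : K → ℝ} (hC : Tendsto C cofinite (𝓝 0)) (hf : ∀ k, HasTate F (C k) (f k)) (hD : 0 ≤ D)
    (hCD : ∀ k, C k ≤ D) (hg : ∀ z, (∀ i, ‖z i‖ ≤ 1) → HasSum (fun k => f k z) (g z)) :
    HasTate F D g := by
  choose c hc hcC hs using hf
  let H : K × (ι →₀ ℕ) → O := fun q => c q.1 q.2
  have hH : Tendsto H cofinite (𝓝 0) := tendsto_cofinite_prod_zero hC (fun k α => hcC k α) hc
  have hH' : Tendsto (fun q : (ι →₀ ℕ) × K => H q.swap) cofinite (𝓝 0) :=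
    hH.comp (Prod.swap_injective.tendsto_cofinite)
  have hcol : ∀ α, Summable fun k => c k α := fun α =>
    NonarchimedeanAddGroup.summable_of_tendsto_cofinite_zero
      (hH.comp (Prod.mk_left_injective α).tendsto_cofinite)
  refine ⟨fun α => ∑' k, c k α, ?_, fun α => ?_, fun z hz => ?_⟩
  · rw [tendsto_cofinite_zero_iff] at hH ⊢
    intro ε hε
    -- A limit of terms below `ε / 2` is only known to be at most `ε / 2`; the halving restores a
    -- strict inequality.
    refine ((hH (ε / 2) (by positivity)).image Prod.snd).subset fun α hα => ?_
    by_contra hcon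
    refine absurd (show ε ≤ ‖∑' k, c k α‖ from hα) (not_le.2 ?_)
    refine lt_of_le_of_lt (norm_le_of_hasSum (hcol α).hasSum (C := ε / 2) (by positivity)
      fun k => ?_) (half_lt_self hε)
    by_contra hk
    exact hcon ⟨(k, α), (not_le.1 hk).le, rfl⟩
  · exact norm_le_of_hasSum (hcol α).hasSum hD fun k => (hcC k α).trans (hCD k)
  · let G : K × (ι →₀ ℕ) → O := fun q => algebraMap ℚ_[p] F (monom z q.2) • H q
    have hG : Summable G := NonarchimedeanAddGroup.summable_of_tendsto_cofinite_zero
      (squeeze_zero_norm (fun q => norm_algebraMap_smul_le (norm_monom_le hz q.2) _)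
        (tendsto_zero_iff_norm_tendsto_zero.1 hH))
    have h1 : HasSum (fun k => f k z) (∑' q, G q) :=
      hG.hasSum.prod_fiberwise fun k => hs k z hz
    have h2 : HasSum G (g z) := (h1.unique (hg z hz)) ▸ hG.hasSum
    refine HasSum.prod_fiberwise (f := fun q : (ι →₀ ℕ) × K => G q.swap)
      ((Equiv.prodComm _ _).hasSum_iff.2 h2) fun α => ?_
    exact (hcol α).hasSum.const_smul (algebraMap ℚ_[p] F (monom z α))

theorem hasTate_monom_smul (β : ι →₀ ℕ) (a : O) :
    HasTate F ‖a‖ (fun z : ι → ℚ_[p] => algebraMap ℚ_[p] F (monom z β) • a) := by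
  classical
  refine ⟨Pi.single β a, ?_, fun α => ?_, fun z _ => ?_⟩
  · rw [tendsto_cofinite_zero_iff]
    refine fun ε hε => (Set.finite_singleton β).subset fun α hα => ?_
    by_contra h
    rw [Set.mem_singleton_iff] at h
    rw [Set.mem_ofPred_eq, Pi.single_eq_of_ne h, norm_zero] at hα
    exact absurd hα (not_le.2 hε)
  · by_cases h : α = β
    · subst h; simp
    · simp [Pi.single_eq_of_ne h]
  · convert hasSum_single β fun α hα => ?_
    · simp
    · simp [Pi.single_eq_of_ne hα]

theorem monom_zero (z : ι → ℚ_[p]) : monom z 0 = 1 := by simp [monom]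

theorem monom_add (z : ι → ℚ_[p]) (α β : ι →₀ ℕ) : monom z (α + β) = monom z α * monom z β := by
  simp [monom, pow_add, Finset.prod_mul_distrib]

theorem hasTate_const (a : O) : HasTate F ‖a‖ (fun _ : ι → ℚ_[p] => a) :=
  (hasTate_monom_smul 0 a).congr fun z _ => by rw [monom_zero, map_one, one_smul]

theorem hasTate_coord (i : ι) : HasTate ℚ_[p] 1 (fun z : ι → ℚ_[p] => z i) := by
  classical
  refine ((hasTate_monom_smul (Finsupp.single i 1) (1 : ℚ_[p])).congr fun z _ => ?_).mono
    norm_one.le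
  rw [monom, Finset.prod_eq_single i]
  · simp
  · intro j _ hj
    simp [hj.symm]
  · simp

theorem HasTate.map {O' : Type*} [NormedCommRing O'] [NormedAlgebra F O'] (L : O →ₗ[F] O')
    {M : ℝ} (hM : ∀ a, ‖L a‖ ≤ M * ‖a‖) (hM0 : 0 ≤ M) (hf : HasTate F C f) :
    HasTate F (M * C) (fun z => L (f z)) := by
  have hL : Continuous L := AddMonoidHomClass.continuous_of_bound L M hM
  obtain ⟨c, hc, hC, hs⟩ := hf
  refine ⟨fun α => L (c α), ?_, fun α => (hM _).trans (by gcongr; exact hC α), fun z hz => ?_⟩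
  · have h := (hL.tendsto 0).comp hc
    rwa [map_zero] at h
  · have h := (hs z hz).map L.toAddMonoidHom hL
    have h' : (⇑L.toAddMonoidHom ∘ fun α => algebraMap ℚ_[p] F (monom z α) • c α)
        = fun α => algebraMap ℚ_[p] F (monom z α) • L (c α) := funext fun α => L.map_smul _ _
    rwa [h'] at h

theorem HasTate.const_mul (a : O) (hf : HasTate F C f) :
    HasTate F (‖a‖ * C) (fun z => a * f z) :=
  hf.map (LinearMap.mulLeft F a) (fun b => norm_mul_le a b) (norm_nonneg a)

theorem HasTate.const_smul (a : F) (hf : HasTate F C f) :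
    HasTate F (‖a‖ * C) (fun z => a • f z) :=
  hf.map (a • LinearMap.id) (fun b => norm_smul_le a b) (norm_nonneg a)

/-- Treating the sum as a family indexed by `Bool` yields the maximum of the bounds, which keeps
integral substitutions within the bound `1`. -/
theorem HasTate.add [CompleteSpace O] [IsUltrametricDist O] (hf : HasTate F C f)
    (hg : HasTate F D g) : HasTate F (max C D) (fun z => f z + g z) := by
  refine hasTate_of_hasSum (K := Bool) (f := fun k => if k then f else g)
    (C := fun k => if k then C else D) ?_ ?_ (le_max_of_le_left hf.nonneg) ?_ ?_
  · rw [cofinite_eq_bot]; exact tendsto_bot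
  · rintro (_ | _) <;> simpa
  · rintro (_ | _) <;> simp
  · intro z _
    convert hasSum_fintype (fun k : Bool => (if k then f else g : (ι → ℚ_[p]) → O) z) using 1
    simp

/-- Multiplication by a monomial shifts exponents and leaves the coefficients alone. Summing the
shifted monomials avoids describing the new coefficient family. -/
theorem HasTate.monom_smul [CompleteSpace O] [IsUltrametricDist O] (β : ι →₀ ℕ)
    (hf : HasTate F C f) :
    HasTate F C (fun z => algebraMap ℚ_[p] F (monom z β) • f z) := by
  have h0 := hf.nonneg
  obtain ⟨c, hc, hC, hs⟩ := hf
  refine hasTate_of_hasSum (f := fun α z => algebraMap ℚ_[p] F (monom z (β + α)) • c α)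
    (tendsto_zero_iff_norm_tendsto_zero.1 hc) (fun α => hasTate_monom_smul _ _) h0 hC
    fun z hz => ?_
  simpa only [monom_add, map_mul, mul_smul] using
    (hs z hz).const_smul (algebraMap ℚ_[p] F (monom z β))

/-- Only the first factor is expanded: each of its terms is a constant and a monomial applied to
`g`. -/
theorem HasTate.mul [CompleteSpace O] [IsUltrametricDist O] (hf : HasTate F C f)
    (hg : HasTate F D g) : HasTate F (C * D) (fun z => f z * g z) := by
  have hC0 := hf.nonneg
  have hD0 := hg.nonneg
  obtain ⟨c, hc, hC, hs⟩ := hf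
  refine hasTate_of_hasSum (C := fun α => ‖c α‖ * D)
    (f := fun α z => algebraMap ℚ_[p] F (monom z α) • (c α * g z)) ?_
    (fun α => (hg.const_mul (c α)).monom_smul α) (mul_nonneg hC0 hD0)
    (fun α => by gcongr; exact hC α) fun z hz => ?_
  · simpa using (tendsto_zero_iff_norm_tendsto_zero.1 hc).mul_const D
  · simpa using (hs z hz).mul_right (g z)

theorem HasTate.smul [CompleteSpace O] [IsUltrametricDist O] {h : (ι → ℚ_[p]) → ℚ_[p]}
    (hh : HasTate ℚ_[p] C h) (hg : HasTate F D g) :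
    HasTate F (C * D) (fun z => algebraMap ℚ_[p] F (h z) • g z) := by
  have hC0 := hh.nonneg
  have hD0 := hg.nonneg
  obtain ⟨c, hc, hC, hs⟩ := hh
  refine hasTate_of_hasSum (C := fun α => ‖c α‖ * D)
    (f := fun α z => algebraMap ℚ_[p] F (monom z α) • (algebraMap ℚ_[p] F (c α) • g z)) ?_
    (fun α => by
      simpa only [norm_algebraMap'] using
        (hg.const_smul (algebraMap ℚ_[p] F (c α))).monom_smul α) (mul_nonneg hC0 hD0)
    (fun α => by gcongr; exact hC α) fun z hz => ?_
  · simpa using (tendsto_zero_iff_norm_tendsto_zero.1 hc).mul_const D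
  · have h1 := ((hs z hz).map (algebraMap ℚ_[p] F)
      (continuous_algebraMap ℚ_[p] F)).smul_const (g z)
    convert h1 using 2 with α
    simp [mul_smul]

theorem HasTate.pow {h : (ι → ℚ_[p]) → ℚ_[p]} (hh : HasTate ℚ_[p] 1 h) (n : ℕ) :
    HasTate ℚ_[p] 1 (fun z => h z ^ n) := by
  induction n with
  | zero => simpa using hasTate_const (F := ℚ_[p]) (1 : ℚ_[p])
  | succ n ih => simpa [pow_succ] using ih.mul hh

theorem hasTate_monom_comp {h : κ → (ι → ℚ_[p]) → ℚ_[p]} (hh : ∀ k, HasTate ℚ_[p] 1 (h k))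
    (α : κ →₀ ℕ) : HasTate ℚ_[p] 1 (fun z => monom (fun k => h k z) α) := by
  classical
  unfold monom
  induction (Finset.univ : Finset κ) using Finset.induction_on with
  | empty => simpa using hasTate_const (F := ℚ_[p]) (1 : ℚ_[p])
  | insert k s hk ih => simpa [Finset.prod_insert hk] using ((hh k).pow (α k)).mul ih

/-- Monomials in series of norm at most `1` again have norm at most `1`, so the substituted series
is a null family of power series. Unlike `HasExpansions.comp_linear`, this covers affine maps and
the quotient `y / x`. -/
theorem HasTate.comp [CompleteSpace O] [IsUltrametricDist O] {f : (κ → ℚ_[p]) → O}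
    (hf : HasTate F C f) {h : κ → (ι → ℚ_[p]) → ℚ_[p]} (hh : ∀ k, HasTate ℚ_[p] 1 (h k)) :
    HasTate F C (fun z => f fun k => h k z) := by
  have h0 := hf.nonneg
  obtain ⟨c, hc, hC, hs⟩ := hf
  refine hasTate_of_hasSum (C := fun α => 1 * ‖c α‖)
    (f := fun α z => algebraMap ℚ_[p] F (monom (fun k => h k z) α) • c α) ?_
    (fun α => (hasTate_monom_comp hh α).smul (hasTate_const (c α))) h0 (by simpa using hC)
    fun z hz => hs _ fun k => (hh k).norm_le hz
  simpa using tendsto_zero_iff_norm_tendsto_zero.1 hc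

/-- The inverse of `x + q z` for units `x` and topologically nilpotent `q`. -/
theorem hasTate_inv {x q : ℚ_[p]} (hx : ‖x‖ = 1) (hq : ‖q‖ < 1) (i : ι) :
    HasTate ℚ_[p] 1 (fun z : ι → ℚ_[p] => (x + q * z i)⁻¹) := by
  have hx0 : x ≠ 0 := by rintro rfl; simp at hx
  have hgeo : Tendsto (fun k : ℕ => ‖q‖ ^ k) cofinite (𝓝 0) := by
    rw [Nat.cofinite_eq_atTop]
    exact tendsto_pow_atTop_nhds_zero_of_lt_one (norm_nonneg _) hq
  -- Geometric series for `x⁻¹ (1 + x⁻¹ q z)⁻¹`; as `x` is a unit, its `k`-th term has norm at most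
  -- `‖q‖ ^ k`.
  refine hasTate_of_hasSum (C := fun k : ℕ => ‖q‖ ^ k)
    (f := fun k z => x⁻¹ * (-(x⁻¹ * q)) ^ k * z i ^ k) hgeo (fun k => ?_) zero_le_one
    (fun k => pow_le_one₀ (norm_nonneg _) hq.le) fun z hz => ?_
  · have := ((hasTate_coord i).pow k).const_mul (x⁻¹ * (-(x⁻¹ * q)) ^ k)
    simpa [hx] using this
  · have h1 : ‖-(x⁻¹ * q) * z i‖ < 1 := by
      rw [norm_mul, norm_neg, norm_mul, norm_inv, hx, inv_one, one_mul]
      exact lt_of_le_of_lt (mul_le_of_le_one_right (norm_nonneg _) (hz i)) hq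
    have h2 := (hasSum_geometric_of_norm_lt_one h1).mul_left x⁻¹
    have h3 : (x + q * z i)⁻¹ = x⁻¹ * (1 - -(x⁻¹ * q) * z i)⁻¹ := by
      rw [← mul_inv]
      congr 1
      field_simp
      ring
    rw [h3]
    simpa only [mul_pow, mul_assoc] using h2

/-! ### Local expansions on a manifold as power series on polydiscs -/

variable {X : Type*} {χ : X → ι → ℚ_[p]} {n : ℕ}

theorem hasExpansions_of_hasTate {f : X → O} (hC : 0 ≤ C)
    (h : ∀ x, ∃ g : (ι → ℚ_[p]) → O, HasTate F C g ∧ ∀ (z : ι → ℚ_[p]) (y : X),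
      (∀ i, ‖z i‖ ≤ 1) → (∀ i, χ y i = χ x i + (p : ℚ_[p]) ^ n * z i) → f y = g z) :
    HasExpansions F χ n C f := by
  refine ⟨hC, fun x => ?_⟩
  obtain ⟨g, ⟨c, hc, hcC, hs⟩, hg⟩ := h x
  exact ⟨c, hc, hcC, fun z y hz hy => hg z y hz hy ▸ hs z hz⟩

theorem HasExpansions.exists_hasTate [CompleteSpace O] [IsUltrametricDist O] {f : X → O}
    (h : HasExpansions F χ n C f) (x : X) : ∃ g : (ι → ℚ_[p]) → O, HasTate F C g ∧
      ∀ (z : ι → ℚ_[p]) (y : X), (∀ i, ‖z i‖ ≤ 1) →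
        (∀ i, χ y i = χ x i + (p : ℚ_[p]) ^ n * z i) → f y = g z := by
  obtain ⟨c, hc, hcC, hs⟩ := h.2 x
  refine ⟨fun z => ∑' α, algebraMap ℚ_[p] F (monom z α) • c α, ⟨c, hc, hcC, fun z hz => ?_⟩,
    fun z y hz hy => (hs z y hz hy).tsum_eq.symm⟩
  -- There may be no point of `X` over `z`, so convergence has to come from the decay of the
  -- coefficients and not from `hs`.
  exact (NonarchimedeanAddGroup.summable_of_tendsto_cofinite_zero
    (squeeze_zero_norm (fun α => norm_algebraMap_smul_le (norm_monom_le hz α) _)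
      (tendsto_zero_iff_norm_tendsto_zero.1 hc))).hasSum

end Tate

/-! ### Homogeneous functions on `W ^ R` as functions on `ℤ_p ^ R` -/

section Trivialization

variable {p : ℕ} [Fact p.Prime] {R : Type*}

/-- The embedding of `ℤ_p ^ R` in affine space. -/
def chartZ (y : R → ℤ_[p]) (r : R) : ℚ_[p] := y r

/-- The embedding of the torus `(ℤ_pˣ) ^ R` in affine space. -/
def chartTorus (t : R → ℤ_[p]ˣ) (r : R) : ℚ_[p] := ((t r : ℤ_[p]) : ℚ_[p])

variable [Fintype R]

/-- The section `y ↦ (1, y)` of `W ^ R → ℤ_p ^ R`. -/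
def slice (y : R → ℤ_[p]) : W p R :=
  ⟨fun r => ![1, y r], fun r => ⟨by simp, by simpa using (y r).norm_le_one⟩⟩

/-- The coordinates `x` of a point `(x, y)` of `W ^ R`. -/
def unitCoord (w : W p R) (r : R) : ℤ_[p]ˣ := PadicInt.mkUnits (w.2 r).1

/-- The map `(x, y) ↦ y / x`, from `W ^ R` to `ℤ_p ^ R`. -/
def ratio (w : W p R) (r : R) : ℤ_[p] :=
  ⟨w.1 r 1 * (w.1 r 0)⁻¹, by rw [norm_mul, norm_inv, (w.2 r).1, inv_one, mul_one]; exact (w.2 r).2⟩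

theorem coe_unitCoord (w : W p R) (r : R) : ((unitCoord w r : ℤ_[p]) : ℚ_[p]) = w.1 r 0 := rfl

theorem coe_ratio (w : W p R) (r : R) : (ratio w r : ℚ_[p]) = w.1 r 1 * (w.1 r 0)⁻¹ := rfl

theorem fst_ne_zero (w : W p R) (r : R) : w.1 r 0 ≠ 0 := fun h => by
  simpa [h] using (w.2 r).1

theorem unitCoord_slice (y : R → ℤ_[p]) : unitCoord (slice y) = 1 := by
  ext r; rfl

theorem ratio_slice (y : R → ℤ_[p]) : ratio (slice y) = y := by
  ext1 r
  refine Subtype.ext ?_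
  rw [coe_ratio]
  simp [slice]

/-- The trivialization `(x, y) = x (1, y / x)` of the torus bundle, possible because `x` is a unit.
-/
theorem coe_apply_eq_unitCoord_mul (w : W p R) (r : R) (j : Fin 2) :
    w.1 r j = ((unitCoord w r : ℤ_[p]) : ℚ_[p]) * (slice (ratio w)).1 r j := by
  have := fst_ne_zero w r
  rw [coe_unitCoord]
  fin_cases j
  · simp [slice]
  · simp only [slice, Fin.mk_one, Matrix.cons_val_one, Matrix.cons_val_fin_one, coe_ratio]
    field_simp

variable {F : Type*} [NormedField F] [NormedAlgebra ℚ_[p] F]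
  {O : Type*} [NormedCommRing O] [NormedAlgebra F O]
  {κ : (R → ℤ_[p]ˣ) →* Oˣ} {n m : ℕ} {C D : ℝ}

/-- The homogeneous function on `W ^ R` with values `g` on the section `y ↦ (1, y)`. -/
def extendHom (κ : (R → ℤ_[p]ˣ) →* Oˣ) (g : (R → ℤ_[p]) → O) (w : W p R) : O :=
  κ (unitCoord w) * g (ratio w)

theorem extendHom_homogeneous (g : (R → ℤ_[p]) → O) (t : R → ℤ_[p]ˣ) (w w' : W p R)
    (h : ∀ r j, w'.1 r j = ((t r : ℤ_[p]) : ℚ_[p]) * w.1 r j) :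
    extendHom κ g w' = κ t * extendHom κ g w := by
  have h1 : unitCoord w' = t * unitCoord w := by
    ext1 r
    refine Units.ext (Subtype.ext ?_)
    rw [coe_unitCoord, h]
    simp [coe_unitCoord]
  have h2 : ratio w' = ratio w := by
    ext1 r
    refine Subtype.ext ?_
    have ht : ((t r : ℤ_[p]) : ℚ_[p]) ≠ 0 := by simp
    have := fst_ne_zero w r
    rw [coe_ratio, coe_ratio, h, h]
    field_simp
  rw [extendHom, extendHom, h1, h2, map_mul, Units.val_mul, mul_assoc]

theorem extendHom_slice (g : (R → ℤ_[p]) → O) (y : R → ℤ_[p]) :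
    extendHom κ g (slice y) = g y := by
  rw [extendHom, unitCoord_slice, ratio_slice, map_one, Units.val_one, one_mul]

theorem extendHom_comp_slice (f : HomFun F (W p R) κ) :
    extendHom κ (fun y => f.1 (slice y)) = f.1 :=
  funext fun w => (f.2.2 _ (slice (ratio w)) w (coe_apply_eq_unitCoord_mul w)).symm

theorem HasExpansions.comp_slice [CompleteSpace O] [IsUltrametricDist O] {f : W p R → O}
    (hf : HasExpansions F (chart (W p R)) n C f) :
    HasExpansions F chartZ n C (fun y => f (slice y)) := by
  refine hasExpansions_of_hasTate hf.1 fun x => ?_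
  obtain ⟨G, hG, hfG⟩ := hf.exists_hasTate (slice x)
  -- Along the section the first coordinate is constantly `1`, so a displacement `z` of the base
  -- becomes `(0, z)`.
  let h : R × Fin 2 → (R → ℚ_[p]) → ℚ_[p] := fun i z => ![0, z i.1] i.2
  have hh : ∀ i, HasTate ℚ_[p] 1 (h i) := by
    rintro ⟨r, j⟩
    fin_cases j
    · exact (hasTate_const (F := ℚ_[p]) (0 : ℚ_[p])).mono (by simp)
    · exact hasTate_coord r
  refine ⟨fun z => G fun i => h i z, hG.comp hh, fun z y hz hy => ?_⟩
  refine hfG _ _ (fun i => (hh i).norm_le hz) ?_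
  rintro ⟨r, j⟩
  fin_cases j
  · simp [h, chart, slice]
  · simpa [h, chart, slice, chartZ] using hy r

/-- Near a point both the torus coordinate and `y / x` are integral power series in the
displacement, so the two expansions can be composed with them and multiplied. The loss in order and
norm depends on `κ` alone, as continuity of distributions requires. The order is raised to at least
`1` so that `x + p ^ N z` remains a unit and can be inverted. -/
theorem HasExpansions.extendHom [CompleteSpace O] [IsUltrametricDist O]
    (hκ : HasExpansions F chartTorus m D (fun t => (κ t : O))) {g : (R → ℤ_[p]) → O}
    (hg : HasExpansions F chartZ n C g) :
    HasExpansions F (chart (W p R)) (max (max n m) 1) (D * C) (extendHom κ g) := by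
  have hN : 1 ≤ max (max n m) 1 := le_max_right _ _
  replace hg := hg.mono_order ((le_max_left n m).trans (le_max_left _ 1))
  replace hκ := hκ.mono_order ((le_max_right n m).trans (le_max_left _ 1))
  set N := max (max n m) 1
  have hq : ‖(p : ℚ_[p]) ^ N‖ < 1 := by
    rw [norm_pow]
    exact pow_lt_one₀ (norm_nonneg _) Padic.norm_p_lt_one (by omega)
  refine hasExpansions_of_hasTate (mul_nonneg hκ.1 hg.1) fun x => ?_
  obtain ⟨G, hG, hgG⟩ := hg.exists_hasTate (ratio x)
  obtain ⟨K, hK, hκK⟩ := hκ.exists_hasTate (unitCoord x)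
  -- Chosen so that `ratio` moves by `p ^ N * h`: with `x = (a, b)`, the difference `(b + p ^ N z₁)
  -- / (a + p ^ N z₀) - b / a` is `p ^ N (z₁ - (b / a) z₀) / (a + p ^ N z₀)`.
  let h : R → (R × Fin 2 → ℚ_[p]) → ℚ_[p] := fun r z =>
    (z (r, 1) + -(x.1 r 1 * (x.1 r 0)⁻¹) * z (r, 0)) * (x.1 r 0 + (p : ℚ_[p]) ^ N * z (r, 0))⁻¹
  have hh : ∀ r, HasTate ℚ_[p] 1 (h r) := fun r => by
    refine (((hasTate_coord (r, (1 : Fin 2))).add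
      ((hasTate_coord (r, (0 : Fin 2))).const_mul (-(x.1 r 1 * (x.1 r 0)⁻¹)))).mul
        (hasTate_inv (x.2 r).1 hq (r, (0 : Fin 2)))).mono ?_
    rw [mul_one, mul_one, norm_neg]
    exact max_le le_rfl (ratio x r).norm_le_one
  refine ⟨fun z => K (fun r => z (r, 0)) * G (fun r => h r z),
    (hK.comp fun r => hasTate_coord (r, 0)).mul (hG.comp hh), fun z y hz hy => ?_⟩
  have hy' : ∀ r j, y.1 r j = x.1 r j + (p : ℚ_[p]) ^ N * z (r, j) := fun r j => hy (r, j)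
  rw [QuatForms.extendHom, hκK (fun r => z (r, 0)) (unitCoord y) (fun r => hz _) fun r => hy (r, 0),
    hgG (fun r => h r z) (ratio y) (fun r => (hh r).norm_le hz)]
  intro r
  have h0 := fst_ne_zero x r
  have h1 := fst_ne_zero y r
  rw [hy'] at h1
  simp only [chartZ, coe_ratio, h, hy']
  field_simp
  ring

variable (F) in
/-- The character `κ` of the torus is locally analytic. -/
def IsAnalyticChar (κ : (R → ℤ_[p]ˣ) →* Oˣ) : Prop :=
  IsLocAnalytic F chartTorus (fun t => (κ t : O))

/-- `extendHom` as a map to `𝒜_κ(W ^ R)`. -/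
def toHomFun [CompleteSpace O] [IsUltrametricDist O] (hκ : IsAnalyticChar F κ)
    (g : (R → ℤ_[p]) → O) (hg : IsLocAnalytic F chartZ g) : HomFun F (W p R) κ :=
  ⟨extendHom κ g, by
    obtain ⟨m, D, hκ⟩ := hκ
    obtain ⟨n, C, hg⟩ := hg
    exact ⟨_, _, hκ.extendHom hg⟩, extendHom_homogeneous g⟩

end Trivialization

/-! ### Expansions of locally analytic functions on `ℤ_p ^ R` -/

section Basis

variable {p : ℕ} [Fact p.Prime]

/-- The coordinate `(y - i) / p ^ n` on the residue class of `y` modulo `p ^ n`, with `i` the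
smallest representative of that class in `ℕ`. -/
def residual (n : ℕ) (y : ℤ_[p]) : ℚ_[p] :=
  ((y : ℚ_[p]) - (PadicInt.toZModPow n y).val) / (p : ℚ_[p]) ^ n

theorem p_pow_ne_zero (n : ℕ) : (p : ℚ_[p]) ^ n ≠ 0 :=
  pow_ne_zero _ (by exact_mod_cast (Fact.out : p.Prime).ne_zero)

theorem coe_eq_add_residual (n : ℕ) (y : ℤ_[p]) :
    (y : ℚ_[p]) = (PadicInt.toZModPow n y).val + (p : ℚ_[p]) ^ n * residual n y := by
  rw [residual, mul_div_cancel₀ _ (p_pow_ne_zero n)]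
  ring

instance (n : ℕ) : NeZero (p ^ n) := ⟨pow_ne_zero _ (Fact.out : p.Prime).ne_zero⟩

theorem toZModPow_add_pow_mul (n : ℕ) (y z : ℤ_[p]) :
    PadicInt.toZModPow n (y + (p : ℤ_[p]) ^ n * z) = PadicInt.toZModPow n y := by
  have : PadicInt.toZModPow n ((p : ℤ_[p]) ^ n) = 0 := by
    rw [← RingHom.mem_ker, PadicInt.ker_toZModPow]
    exact Ideal.mem_span_singleton_self _
  rw [map_add, map_mul, this, zero_mul, add_zero]

theorem toZModPow_val (n : ℕ) (i : ZMod (p ^ n)) :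
    PadicInt.toZModPow n ((i.val : ℕ) : ℤ_[p]) = i := by
  rw [map_natCast, ZMod.natCast_val, ZMod.cast_id]

theorem norm_residual_le (n : ℕ) (y : ℤ_[p]) : ‖residual n y‖ ≤ 1 := by
  have h : y - ((PadicInt.toZModPow n y).val : ℕ) ∈ RingHom.ker (PadicInt.toZModPow n) := by
    rw [RingHom.mem_ker, map_sub, toZModPow_val, sub_self]
  rw [PadicInt.ker_toZModPow, Ideal.mem_span_singleton] at h
  obtain ⟨d, hd⟩ := h
  have h2 : (y : ℚ_[p]) - (PadicInt.toZModPow n y).val = (p : ℚ_[p]) ^ n * d := by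
    exact_mod_cast congrArg (fun u : ℤ_[p] => (u : ℚ_[p])) hd
  rw [residual, h2, mul_div_cancel_left₀ _ (p_pow_ne_zero n)]
  exact d.norm_le_one

theorem toZModPow_of_congr {n : ℕ} {x y : ℤ_[p]} {z : ℚ_[p]} (hz : ‖z‖ ≤ 1)
    (h : (y : ℚ_[p]) = x + (p : ℚ_[p]) ^ n * z) :
    PadicInt.toZModPow n y = PadicInt.toZModPow n x := by
  let z' : ℤ_[p] := ⟨z, hz⟩
  have : y = x + (p : ℤ_[p]) ^ n * z' := by
    refine Subtype.ext ?_
    rw [h]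
    push_cast
    rfl
  rw [this, toZModPow_add_pow_mul]

theorem residual_of_congr {n : ℕ} {x y : ℤ_[p]} {z : ℚ_[p]} (hz : ‖z‖ ≤ 1)
    (h : (y : ℚ_[p]) = x + (p : ℚ_[p]) ^ n * z) : residual n y = residual n x + z := by
  have := p_pow_ne_zero (p := p) n
  rw [residual, residual, toZModPow_of_congr hz h, h]
  field_simp
  ring

/-- The functions `((y - i) / p ^ n) ^ k` on the residue classes `i` modulo `p ^ n`, extended by
zero to `ℤ_p`. -/
def ballPow (n : ℕ) (b : ZMod (p ^ n) × ℕ) (y : ℤ_[p]) : ℚ_[p] :=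
  if PadicInt.toZModPow n y = b.1 then residual n y ^ b.2 else 0

theorem norm_ballPow_le (n : ℕ) (b : ZMod (p ^ n) × ℕ) (y : ℤ_[p]) : ‖ballPow n b y‖ ≤ 1 := by
  unfold ballPow
  split_ifs
  · rw [norm_pow]
    exact pow_le_one₀ (norm_nonneg _) (norm_residual_le n y)
  · simp

variable {R : Type*} [Fintype R]

/-- The products of the functions `ballPow` in several variables. -/
def polyBallPow (n : ℕ) (q : R → ZMod (p ^ n) × ℕ) (y : R → ℤ_[p]) : ℚ_[p] :=
  ∏ r, ballPow n (q r) (y r)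

variable {F : Type*} [NormedField F] [NormedAlgebra ℚ_[p] F]
  {O : Type*} [NormedCommRing O] [NormedAlgebra F O]
  {κ : (R → ℤ_[p]ˣ) →* Oˣ} {n : ℕ} {C : ℝ} {g : (R → ℤ_[p]) → O}

theorem HasTate.prod {ι : Type*} [Fintype ι] {h : R → (ι → ℚ_[p]) → ℚ_[p]}
    (hh : ∀ r, HasTate ℚ_[p] 1 (h r)) : HasTate ℚ_[p] 1 (fun z => ∏ r, h r z) := by
  classical
  induction (Finset.univ : Finset R) using Finset.induction_on with
  | empty => simpa using hasTate_const (F := ℚ_[p]) (1 : ℚ_[p])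
  | insert k s hk ih => simpa [Finset.prod_insert hk] using (hh k).mul ih

variable (F) in
/-- `g` is the sum of the functions `polyBallPow n q` with coefficients `c q` tending to zero. -/
def IsExpansion (n : ℕ) (c : (R → ZMod (p ^ n) × ℕ) → O) (g : (R → ℤ_[p]) → O) : Prop :=
  Tendsto c cofinite (𝓝 0) ∧
    ∀ y, HasSum (fun q => algebraMap ℚ_[p] F (polyBallPow n q y) • c q) (g y)

/-- On a ball of radius `p ^ (-n)` the residue classes are fixed and `residual` moves by `z`, so
each `polyBallPow` is either zero or a product of powers of integral affine functions. -/
theorem IsExpansion.hasExpansions [CompleteSpace O] [IsUltrametricDist O]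
    {c : (R → ZMod (p ^ n) × ℕ) → O} (h : IsExpansion F n c g) (hC0 : 0 ≤ C)
    (hC : ∀ q, ‖c q‖ ≤ C) : HasExpansions F chartZ n C g := by
  refine hasExpansions_of_hasTate hC0 fun x => ?_
  let G : (R → ZMod (p ^ n) × ℕ) → (R → ℚ_[p]) → O := fun q z => algebraMap ℚ_[p] F
    (∏ r, if PadicInt.toZModPow n (x r) = (q r).1 then (residual n (x r) + z r) ^ (q r).2 else 0)
      • c q
  have hG : ∀ q, HasTate F ‖c q‖ (G q) := fun q => by
    rw [← one_mul ‖c q‖]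
    refine (HasTate.prod fun r => ?_).smul (hasTate_const (c q))
    split_ifs
    · exact (((hasTate_const (F := ℚ_[p]) (residual n (x r))).add (hasTate_coord r)).mono
        (max_le (norm_residual_le n _) le_rfl)).pow _
    · exact (hasTate_const (F := ℚ_[p]) (0 : ℚ_[p])).mono (by simp)
  have hc := tendsto_zero_iff_norm_tendsto_zero.1 h.1
  refine ⟨fun z => ∑' q, G q z, hasTate_of_hasSum hc hG hC0 hC fun z hz => ?_,
    fun z y hz hy => ?_⟩
  · exact (NonarchimedeanAddGroup.summable_of_tendsto_cofinite_zero
      (squeeze_zero_norm (fun q => (hG q).norm_le hz) hc)).hasSum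
  · rw [← (h.2 y).tsum_eq]
    refine tsum_congr fun q => ?_
    simp only [G, ← toZModPow_of_congr (hz _) (hy _), ← residual_of_congr (hz _) (hy _)]
    rfl

/-- Expanding around the natural representative of each residue class makes the local coordinate
equal to `residual`, so the local coefficients serve as the global ones. -/
theorem HasExpansions.exists_isExpansion (h : HasExpansions F chartZ n C g) :
    ∃ c : (R → ZMod (p ^ n) × ℕ) → O, IsExpansion F n c g ∧ ∀ q, ‖c q‖ ≤ C := by
  classical
  choose c hc hC hs using fun i : R → ZMod (p ^ n) =>
    h.2 fun r => ((i r).val : ℤ_[p])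
  -- Separates an index into the tuple of residue classes and the exponent of the monomial.
  let ε : (R → ZMod (p ^ n) × ℕ) ≃ (R → ZMod (p ^ n)) × (R →₀ ℕ) :=
    (Equiv.arrowProdEquivProdArrow R (fun _ => ZMod (p ^ n)) (fun _ => ℕ)).trans
      ((Equiv.refl _).prodCongr Finsupp.equivFunOnFinite.symm)
  refine ⟨fun q => c (ε q).1 (ε q).2, ⟨?_, fun y => ?_⟩, fun q => hC _ _⟩
  · have h1 : Tendsto (fun u : (R → ZMod (p ^ n)) × (R →₀ ℕ) => c u.1 u.2) cofinite (𝓝 0) := by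
      -- There are finitely many tuples of classes, so `cofinite` is `⊥` on them and a constant
      -- bound is admissible.
      refine tendsto_cofinite_prod_zero (C := fun _ => C) ?_ (fun i α => hC i α) hc
      rw [cofinite_eq_bot]
      exact tendsto_bot
    exact h1.comp ε.injective.tendsto_cofinite
  · let i : R → ZMod (p ^ n) := fun r => PadicInt.toZModPow n (y r)
    have hinj : Function.Injective fun α : R →₀ ℕ => ε.symm (i, α) :=
      ε.symm.injective.comp (Prod.mk_right_injective i)
    -- Only the monomials supported on the class of `y` contribute at `y`.
    refine (hinj.hasSum_iff fun q hq => ?_).1 ?_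
    · obtain ⟨r, hr⟩ : ∃ r, PadicInt.toZModPow n (y r) ≠ (q r).1 := by
        by_contra! hcon
        refine hq ⟨(ε q).2, ?_⟩
        rw [Equiv.symm_apply_eq, Prod.ext_iff]
        exact ⟨funext hcon, rfl⟩
      rw [polyBallPow, Finset.prod_eq_zero (Finset.mem_univ r), map_zero, zero_smul]
      rw [ballPow, if_neg hr]
    · convert hs i (fun r => residual n (y r)) y (fun r => norm_residual_le n _)
        (fun r => (coe_eq_add_residual n (y r)).trans
          (by simp only [chartZ, i, PadicInt.coe_natCast])) using 2 with α
      simp only [Function.comp_apply, Equiv.apply_symm_apply]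
      congr 2
      refine Finset.prod_congr rfl fun r _ => ?_
      rw [ballPow]
      exact if_pos rfl

/-! ### Uniqueness of the expansion -/

/-- A power series with bounded coefficients that vanishes at all powers of `p` is zero. -/
theorem eq_zero_of_hasSum_pow [IsUltrametricDist O] {d : ℕ → O} (hC : ∀ k, ‖d k‖ ≤ C)
    (h : ∀ m : ℕ, HasSum (fun k => algebraMap ℚ_[p] F (((p : ℚ_[p]) ^ m) ^ k) • d k) 0) (k : ℕ) :
    d k = 0 := by
  induction k using Nat.strong_induction_on with
  | _ k ih =>
    have hp0 : 0 < ‖(p : ℚ_[p])‖ := norm_pos_iff.2 (by simpa using p_pow_ne_zero (p := p) 1)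
    have hC0 : 0 ≤ C := (norm_nonneg _).trans (hC 0)
    -- With the coefficients below `k` already zero, the `k`-th term at `p ^ m` is cancelled by
    -- terms of size at most `‖p‖ ^ (m (k + 1)) C`. Dividing by `‖p‖ ^ (m k)` leaves a bound that
    -- tends to zero with `m`.
    have key : ∀ m : ℕ, ‖d k‖ ≤ ‖(p : ℚ_[p])‖ ^ m * C := fun m => by
      have h1 := (h m).sub (hasSum_single (f := fun j => if j = k then
        algebraMap ℚ_[p] F (((p : ℚ_[p]) ^ m) ^ k) • d k else 0) k fun j hj => if_neg hj)
      rw [if_pos rfl, zero_sub] at h1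
      have h2 := norm_le_of_hasSum h1 (C := ‖(p : ℚ_[p])‖ ^ (m * (k + 1)) * C) (by positivity)
        fun j => ?_
      · rw [norm_neg] at h2
        have h3 : ‖d k‖ = ‖(p : ℚ_[p])‖⁻¹ ^ (m * k) *
            ‖algebraMap ℚ_[p] F (((p : ℚ_[p]) ^ m) ^ k) • d k‖ := by
          rw [norm_smul, norm_algebraMap', norm_pow, norm_pow, ← pow_mul, inv_pow, ← mul_assoc,
            inv_mul_cancel₀ (pow_pos hp0 _).ne', one_mul]
        rw [h3]
        calc _ ≤ ‖(p : ℚ_[p])‖⁻¹ ^ (m * k) * (‖(p : ℚ_[p])‖ ^ (m * (k + 1)) * C) := by gcongr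
          _ = ‖(p : ℚ_[p])‖ ^ m * C := by
            rw [mul_add_one, pow_add, inv_pow]
            field_simp
      · rcases lt_trichotomy j k with hj | rfl | hj
        · rw [ih j hj, if_neg hj.ne, smul_zero, sub_zero, norm_zero]
          positivity
        · rw [if_pos rfl, sub_self, norm_zero]
          positivity
        · rw [if_neg hj.ne', sub_zero, norm_smul, norm_algebraMap', norm_pow, norm_pow, ← pow_mul]
          refine mul_le_mul (pow_le_pow_of_le_one hp0.le Padic.norm_p_lt_one.le ?_) (hC j)
            (norm_nonneg _) (by positivity)
          exact Nat.mul_le_mul_left m hj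
    have hlim : Tendsto (fun m : ℕ => ‖(p : ℚ_[p])‖ ^ m * C) atTop (𝓝 0) := by
      simpa using (tendsto_pow_atTop_nhds_zero_of_lt_one hp0.le Padic.norm_p_lt_one).mul_const C
    exact norm_le_zero_iff.1 (ge_of_tendsto hlim (Eventually.of_forall key))

/-- At the points `i + p ^ n p ^ m` only the class `i` contributes, and the local coordinate is `p ^
m`. -/
theorem eq_zero_of_hasSum_ballPow [IsUltrametricDist O] {c : ZMod (p ^ n) × ℕ → O}
    (hC : ∀ b, ‖c b‖ ≤ C)
    (h : ∀ y, HasSum (fun b => algebraMap ℚ_[p] F (ballPow n b y) • c b) 0)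
    (b : ZMod (p ^ n) × ℕ) : c b = 0 := by
  obtain ⟨i, k⟩ := b
  refine eq_zero_of_hasSum_pow (F := F) (p := p) (d := fun k => c (i, k)) (fun k => hC _)
    (fun m => ?_) k
  have hz : ‖(p : ℚ_[p]) ^ m‖ ≤ 1 := by
    rw [norm_pow]
    exact pow_le_one₀ (norm_nonneg _) Padic.norm_p_lt_one.le
  have hy : (((i.val : ℤ_[p]) + (p : ℤ_[p]) ^ n * (p : ℤ_[p]) ^ m : ℤ_[p]) : ℚ_[p])
      = ((i.val : ℤ_[p]) : ℚ_[p]) + (p : ℚ_[p]) ^ n * (p : ℚ_[p]) ^ m := by push_cast; rfl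
  have h1 : PadicInt.toZModPow n ((i.val : ℤ_[p]) + (p : ℤ_[p]) ^ n * (p : ℤ_[p]) ^ m) = i := by
    rw [toZModPow_add_pow_mul, toZModPow_val]
  have h2 : residual n ((i.val : ℤ_[p]) + (p : ℤ_[p]) ^ n * (p : ℤ_[p]) ^ m)
      = (p : ℚ_[p]) ^ m := by
    rw [residual_of_congr hz hy, residual, toZModPow_val, PadicInt.coe_natCast,
      sub_self, zero_div, zero_add]
  have hs := h ((i.val : ℤ_[p]) + (p : ℤ_[p]) ^ n * (p : ℤ_[p]) ^ m)
  rw [← (Prod.mk_right_injective i).hasSum_iff] at hs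
  · convert hs using 2 with k
    rw [Function.comp_apply, ballPow, h1, if_pos rfl, h2]
  · rintro ⟨j, k⟩ hjk
    have : i ≠ j := by
      rintro rfl
      exact hjk ⟨k, rfl⟩
    rw [ballPow, h1, if_neg this, map_zero, zero_smul]

theorem polyBallPow_two (q : Fin 2 → ZMod (p ^ n) × ℕ) (y : Fin 2 → ℤ_[p]) :
    polyBallPow n q y = ballPow n (q 0) (y 0) * ballPow n (q 1) (y 1) := by
  rw [polyBallPow, Fin.prod_univ_two]

/-- The one-variable statement is applied twice, first to the row sums with the second variable
fixed, then inside each row. -/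
theorem IsExpansion.eq_zero [CompleteSpace O] [IsUltrametricDist O]
    {c : (Fin 2 → ZMod (p ^ n) × ℕ) → O} (h : IsExpansion F n c 0)
    (q : Fin 2 → ZMod (p ^ n) × ℕ) : c q = 0 := by
  obtain ⟨C, hC⟩ := exists_norm_le_of_tendsto_zero h.1
  have hC0 : 0 ≤ C := (norm_nonneg _).trans (hC q)
  have hsmul : ∀ b (y : ℤ_[p]) (a : O), ‖algebraMap ℚ_[p] F (ballPow n b y) • a‖ ≤ ‖a‖ :=
    fun b y a => norm_algebraMap_smul_le (norm_ballPow_le n b y) a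
  let c' : (ZMod (p ^ n) × ℕ) × (ZMod (p ^ n) × ℕ) → O := fun u =>
    c ((finTwoArrowEquiv _).symm u)
  have hc' : Tendsto c' cofinite (𝓝 0) :=
    h.1.comp (finTwoArrowEquiv _).symm.injective.tendsto_cofinite
  have hrow : ∀ b₁ (y : ℤ_[p]),
      Summable fun b₂ => algebraMap ℚ_[p] F (ballPow n b₂ y) • c' (b₁, b₂) := fun b₁ y =>
    NonarchimedeanAddGroup.summable_of_tendsto_cofinite_zero (squeeze_zero_norm
      (fun b₂ => hsmul b₂ y _) (tendsto_zero_iff_norm_tendsto_zero.1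
        (hc'.comp (Prod.mk_right_injective b₁).tendsto_cofinite)))
  have hzero : ∀ (y : ℤ_[p]) b₁, ∑' b₂, algebraMap ℚ_[p] F (ballPow n b₂ y) • c' (b₁, b₂) = 0 := by
    intro y₂
    -- With `y₂` fixed, the row sums are bounded coefficients of an expansion of zero in `y₁`.
    refine eq_zero_of_hasSum_ballPow (F := F) (C := C) (fun b₁ => norm_le_of_hasSum
      (hrow b₁ y₂).hasSum hC0 fun b₂ => (hsmul _ _ _).trans (hC _)) fun y₁ => ?_
    refine ((finTwoArrowEquiv _).symm.hasSum_iff.2 (h.2 ![y₁, y₂])).prod_fiberwise fun b₁ => ?_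
    convert (hrow b₁ y₂).hasSum.const_smul (algebraMap ℚ_[p] F (ballPow n b₁ y₁)) using 2 with b₂
    simp [polyBallPow_two, mul_smul, c']
  have := eq_zero_of_hasSum_ballPow (F := F) (c := fun b₂ => c' (q 0, b₂)) (fun b₂ => hC _)
    (fun y => hzero y (q 0) ▸ (hrow (q 0) y).hasSum) (q 1)
  rw [← this]
  simp only [c']
  congr 1
  ext i : 1
  fin_cases i <;> rfl

end Basis

/-! ### Approximation by the functions `ballPow` -/

section Approximation

variable {p : ℕ} [Fact p.Prime] {R : Type*} [Fintype R]
  {F : Type*} [NormedField F] [NormedAlgebra ℚ_[p] F]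
  {O : Type*} [NormedCommRing O] [NormedAlgebra F O]
  {κ : (R → ℤ_[p]ˣ) →* Oˣ} {n m : ℕ} {C D : ℝ} {g h : (R → ℤ_[p]) → O}
  {c d : (R → ZMod (p ^ n) × ℕ) → O}

theorem hasSum_iff_eventually {J : Type*} {f : J → O} {a : O} :
    HasSum f a ↔ ∀ ε > 0, ∃ S₀ : Finset J, ∀ S, S₀ ⊆ S → ‖(∑ j ∈ S, f j) - a‖ < ε := by
  rw [HasSum, SummationFilter.unconditional_filter, Metric.tendsto_nhds]
  simp only [eventually_atTop, dist_eq_norm]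

theorem IsExpansion.add (hg : IsExpansion F n c g) (hh : IsExpansion F n d h) :
    IsExpansion F n (c + d) (g + h) := by
  refine ⟨?_, fun y => ?_⟩
  · have := hg.1.add hh.1
    rwa [add_zero] at this
  simpa only [Pi.add_apply, smul_add] using (hg.2 y).add (hh.2 y)

theorem IsExpansion.smul (a : O) (hg : IsExpansion F n c g) :
    IsExpansion F n (a • c) (a • g) := by
  refine ⟨?_, fun y => ?_⟩
  · have := hg.1.const_mul a
    rwa [mul_zero] at this
  simpa only [Pi.smul_apply, smul_eq_mul, mul_smul_comm] using (hg.2 y).mul_left a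

theorem isExpansion_finset [DecidableEq (R → ZMod (p ^ n) × ℕ)]
    (S : Finset (R → ZMod (p ^ n) × ℕ)) (c : (R → ZMod (p ^ n) × ℕ) → O) :
    IsExpansion F n (fun q => if q ∈ S then c q else 0)
      (fun y => ∑ q ∈ S, algebraMap ℚ_[p] F (polyBallPow n q y) • c q) := by
  refine ⟨tendsto_nhds_of_eventually_eq ?_, fun y => ?_⟩
  · rw [eventually_cofinite]
    refine S.finite_toSet.subset fun q hq => ?_
    by_contra hqS
    exact hq (if_neg hqS)
  · have h1 : HasSum _ _ := hasSum_sum_of_ne_finset_zero (s := S)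
      (f := fun q => algebraMap ℚ_[p] F (polyBallPow n q y) • if q ∈ S then c q else 0)
      fun q hq => by rw [if_neg hq, smul_zero]
    convert h1 using 1
    exact Finset.sum_congr rfl fun q hq => by rw [if_pos hq]

/-- The threshold set consists of the finitely many indices with coefficient of norm at least `ε`.
By the ultrametric inequality the remainder is bounded by its largest coefficient. -/
theorem IsExpansion.exists_finset [CompleteSpace O] [IsUltrametricDist O]
    (hg : IsExpansion F n c g) {ε : ℝ} (hε : 0 < ε) :
    ∃ S₀ : Finset (R → ZMod (p ^ n) × ℕ), ∀ S, S₀ ⊆ S → HasExpansions F chartZ n ε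
      (fun y => g y - ∑ q ∈ S, algebraMap ℚ_[p] F (polyBallPow n q y) • c q) := by
  classical
  refine ⟨(tendsto_cofinite_zero_iff.1 hg.1 ε hε).toFinset, fun S hS => ?_⟩
  have h1 := hg.add ((isExpansion_finset S c).smul (-1))
  refine IsExpansion.hasExpansions (c := fun q => if q ∈ S then 0 else c q) ?_ hε.le fun q => ?_
  · convert h1 using 1
    · ext q
      simp only [Pi.add_apply, Pi.smul_apply, smul_eq_mul]
      split_ifs <;> simp
    · ext y
      simp [sub_eq_add_neg]
  · split_ifs with hq
    · simpa using hε.le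
    · by_contra hcon
      exact hq (hS (by simpa using (not_le.1 hcon).le))

/-- The bound is `‖(1 : O)‖` because the norm of `O` is not normalized. Its independence of `q` is
what later bounds all values of a distribution on one order. -/
theorem hasExpansions_polyBallPow [CompleteSpace O] [IsUltrametricDist O]
    (q : R → ZMod (p ^ n) × ℕ) :
    HasExpansions F chartZ n ‖(1 : O)‖
      (fun y => algebraMap ℚ_[p] F (polyBallPow n q y) • (1 : O)) := by
  classical
  have h1 := (isExpansion_finset (F := F) {q} (fun _ => (1 : O))).hasExpansions
    (norm_nonneg (1 : O)) fun q' => ?_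
  · simpa using h1
  · split_ifs <;> simp

variable [CompleteSpace O] [IsUltrametricDist O]

/-- The homogeneous function on `W ^ R` with restriction `polyBallPow n q` to `ℤ_p ^ R`. -/
def basisFun (hκ : IsAnalyticChar F κ) (n : ℕ) (q : R → ZMod (p ^ n) × ℕ) :
    HomFun F (W p R) κ :=
  toHomFun hκ (fun y => algebraMap ℚ_[p] F (polyBallPow n q y) • (1 : O))
    ⟨n, _, hasExpansions_polyBallPow q⟩

theorem basisFun_slice (hκ : IsAnalyticChar F κ) (q : R → ZMod (p ^ n) × ℕ) (y : R → ℤ_[p]) :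
    (basisFun hκ n q).1 (slice y) = algebraMap ℚ_[p] F (polyBallPow n q y) • (1 : O) :=
  extendHom_slice (κ := κ) (fun y => algebraMap ℚ_[p] F (polyBallPow n q y) • (1 : O)) y

theorem sub_sum_basisFun_slice (hκ : IsAnalyticChar F κ) (f : HomFun F (W p R) κ)
    (S : Finset (R → ZMod (p ^ n) × ℕ)) (y : R → ℤ_[p]) :
    (f - ∑ q ∈ S, c q • basisFun hκ n q).1 (slice y)
      = f.1 (slice y) - ∑ q ∈ S, algebraMap ℚ_[p] F (polyBallPow n q y) • c q := by
  rw [Submodule.coe_sub, Pi.sub_apply, Submodule.coe_sum, Finset.sum_apply]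
  congr 1
  refine Finset.sum_congr rfl fun q _ => ?_
  rw [Submodule.coe_smul, Pi.smul_apply, basisFun_slice, smul_eq_mul, mul_smul_comm, mul_one]

/-- Continuity on `W ^ R` becomes continuity on `ℤ_p ^ R`, since `extendHom` changes order and norm
by amounts depending only on `κ`. -/
theorem Distr.exists_slice_bound (hκ : IsAnalyticChar F κ) (μ : Distr F (W p R) κ) (n : ℕ) :
    ∃ M : ℝ, 0 ≤ M ∧ ∀ (f : HomFun F (W p R) κ) (C : ℝ),
      HasExpansions F chartZ n C (fun y => f.1 (slice y)) → ‖μ.1 f‖ ≤ M * C := by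
  obtain ⟨m, D, hκ⟩ := hκ
  obtain ⟨M, hM⟩ := μ.2 (max (max n m) 1)
  -- The constant in the definition of `Distr` need not be nonnegative.
  refine ⟨max M 0 * D, mul_nonneg (le_max_right _ _) hκ.1, fun f C hf => ?_⟩
  have h1 := hκ.extendHom hf
  rw [extendHom_comp_slice] at h1
  refine (hM f _ h1).trans ?_
  rw [mul_assoc]
  exact mul_le_mul_of_nonneg_right (le_max_left _ _) h1.1

/-- Finite partial sums approximate `f` in the norm of order `n`, for which `μ` is bounded. A
distribution is thus determined by its values at the functions `basisFun`. -/
theorem Distr.hasSum (hκ : IsAnalyticChar F κ) (μ : Distr F (W p R) κ) {f : HomFun F (W p R) κ}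
    (hf : IsExpansion F n c (fun y => f.1 (slice y))) :
    HasSum (fun q => c q * μ.1 (basisFun hκ n q)) (μ.1 f) := by
  obtain ⟨M, hM0, hM⟩ := Distr.exists_slice_bound hκ μ n
  rw [hasSum_iff_eventually]
  intro ε hε
  -- The denominator `M + 1` also covers `M = 0`.
  obtain ⟨S₀, hS₀⟩ := hf.exists_finset (ε := ε / (M + 1)) (by positivity)
  refine ⟨S₀, fun S hS => ?_⟩
  have h1 := hM (f - ∑ q ∈ S, c q • basisFun hκ n q) _
    (by simpa only [sub_sum_basisFun_slice] using hS₀ S hS)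
  rw [map_sub, map_sum, norm_sub_rev] at h1
  simp only [map_smul, smul_eq_mul] at h1
  refine h1.trans_lt ?_
  rw [← mul_div_assoc, div_lt_iff₀ (by positivity)]
  nlinarith

end Approximation

/-! ### Products of distributions -/

section Product

variable {p : ℕ} [Fact p.Prime] {F : Type*} [NormedField F] [NormedAlgebra ℚ_[p] F]

/-! ### Functionals with prescribed bounded values at the monomials -/

section Values

variable {O : Type*} [NormedCommRing O] [NormedAlgebra F O] [CompleteSpace O]
  [IsUltrametricDist O] {κ : (Fin 2 → ℤ_[p]ˣ) →* Oˣ} {n : ℕ} {C M : ℝ}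
  {V : (Fin 2 → ZMod (p ^ n) × ℕ) → O}

/-- The value `v` at `f` of the functional with value `V q` at `polyBallPow n q`. -/
def IsValue (V : (Fin 2 → ZMod (p ^ n) × ℕ) → O) (f : HomFun F (W p (Fin 2)) κ) (v : O) : Prop :=
  ∃ c, IsExpansion F n c (fun y => f.1 (slice y)) ∧ HasSum (fun q => c q * V q) v

variable {f f' : HomFun F (W p (Fin 2)) κ} {v v' : O}

/-- Bounded values against null coefficients give a convergent series; the bound on `v` is what
makes the resulting functional continuous. -/
theorem exists_isValue (hV : ∀ q, ‖V q‖ ≤ M)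
    (hf : HasExpansions F chartZ n C (fun y => f.1 (slice y))) :
    ∃ v, IsValue V f v ∧ ‖v‖ ≤ C * M := by
  obtain ⟨c, hc, hC⟩ := hf.exists_isExpansion
  have hM0 : 0 ≤ M := (norm_nonneg _).trans (hV fun _ => (0, 0))
  have hle : ∀ q, ‖c q * V q‖ ≤ ‖c q‖ * M := fun q =>
    (norm_mul_le _ _).trans (by gcongr; exact hV q)
  have hs : Summable fun q => c q * V q :=
    NonarchimedeanAddGroup.summable_of_tendsto_cofinite_zero (squeeze_zero_norm hle
      (by simpa using (tendsto_zero_iff_norm_tendsto_zero.1 hc.1).mul_const M))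
  exact ⟨_, ⟨c, hc, hs.hasSum⟩, norm_le_of_hasSum hs.hasSum (mul_nonneg hf.1 hM0)
    fun q => (hle q).trans (by gcongr; exact hC q)⟩

theorem IsValue.add (hv : IsValue V f v) (hv' : IsValue V f' v') :
    IsValue V (f + f') (v + v') := by
  obtain ⟨c, hc, hs⟩ := hv
  obtain ⟨c', hc', hs'⟩ := hv'
  refine ⟨c + c', hc.add hc', ?_⟩
  simpa only [Pi.add_apply, add_mul] using hs.add hs'

theorem IsValue.smul (a : O) (hv : IsValue V f v) : IsValue V (a • f) (a * v) := by
  obtain ⟨c, hc, hs⟩ := hv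
  refine ⟨a • c, hc.smul a, ?_⟩
  simpa only [Pi.smul_apply, smul_eq_mul, mul_assoc] using hs.mul_left a

/-- Two expansions of `f` differ by an expansion of zero, so their coefficients agree by
`IsExpansion.eq_zero`. -/
theorem IsValue.unique (hv : IsValue V f v) (hv' : IsValue V f v') : v = v' := by
  obtain ⟨c, hc, hs⟩ := hv
  obtain ⟨c', hc', hs'⟩ := hv'
  have h1 := hc.add (hc'.smul (-1))
  have h2 : (fun y => f.1 (slice y)) + (-1 : O) • (fun y => f.1 (slice y)) = 0 := by
    ext; simp
  rw [h2] at h1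
  have h3 : c = c' := funext fun q => by
    have := h1.eq_zero q
    simpa [← sub_eq_add_neg, sub_eq_zero] using this
  exact hs.unique (h3 ▸ hs')

theorem IsValue.sum {J : Type*} (S : Finset J) {f : J → HomFun F (W p (Fin 2)) κ} {v : J → O}
    (h : ∀ j, IsValue V (f j) (v j)) : IsValue V (∑ j ∈ S, f j) (∑ j ∈ S, v j) := by
  classical
  induction S using Finset.induction_on with
  | empty =>
    refine ⟨0, ⟨tendsto_const_nhds, fun y => ?_⟩, ?_⟩ <;> simp
  | insert j S hj ih =>
    rw [Finset.sum_insert hj, Finset.sum_insert hj]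
    exact (h j).add ih

end Values

/-! ### External products of series in the completed tensor product -/

variable {O₁ O₂ : Type*} [NormedCommRing O₁] [NormedAlgebra F O₁] [NormedCommRing O₂]
  [NormedAlgebra F O₂]

theorem inl_mul_inr (a : O₁) (b : O₂) :
    inl F O₁ O₂ a * inr F O₁ O₂ b = ((ptmul F a b : ProjTensor F O₁ O₂) : CTensor F O₁ O₂) := by
  have : ptmul F a b = ptmul F a (1 : O₂) * ptmul F (1 : O₁) b := by
    have := Algebra.TensorProduct.tmul_mul_tmul (R := F) a 1 (1 : O₂) b
    rw [mul_one, one_mul] at this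
    exact this.symm
  rw [this, UniformSpace.Completion.coe_mul]
  rfl

/-- A pure tensor is one of its own decompositions, so it bounds its projective seminorm. Only this
inequality is needed for the estimates below. -/
theorem norm_inl_mul_inr_le (a : O₁) (b : O₂) :
    ‖inl F O₁ O₂ a * inr F O₁ O₂ b‖ ≤ ‖a‖ * ‖b‖ := by
  rw [inl_mul_inr, UniformSpace.Completion.norm_coe]
  exact projNorm_le (by positivity) (AddSubgroup.subset_closure ⟨a, b, le_rfl, rfl⟩)

variable (F O₁ O₂) in
/-- `inl` as an `F`-linear map. -/
def inlLinear : O₁ →ₗ[F] CTensor F O₁ O₂ where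
  toFun := inl F O₁ O₂
  map_add' := map_add _
  map_smul' c a := by
    refine Eq.trans ?_ (UniformSpace.Completion.coe_smul c (ptmul F a (1 : O₂)))
    have h : ptmul F (c • a) (1 : O₂) = c • ptmul F a (1 : O₂) :=
      (TensorProduct.smul_tmul' c a (1 : O₂)).symm
    exact congrArg (fun t : ProjTensor F O₁ O₂ => (t : CTensor F O₁ O₂)) h

variable (F O₁ O₂) in
/-- `inr` as an `F`-linear map. -/
def inrLinear : O₂ →ₗ[F] CTensor F O₁ O₂ where
  toFun := inr F O₁ O₂
  map_add' := map_add _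
  map_smul' c b := by
    refine Eq.trans ?_ (UniformSpace.Completion.coe_smul c (ptmul F (1 : O₁) b))
    have h : ptmul F (1 : O₁) (c • b) = c • ptmul F (1 : O₁) b :=
      TensorProduct.tmul_smul c (1 : O₁) b
    exact congrArg (fun t : ProjTensor F O₁ O₂ => (t : CTensor F O₁ O₂)) h

theorem inl_smul (c : F) (a : O₁) : inl F O₁ O₂ (c • a) = c • inl F O₁ O₂ a :=
  (inlLinear F O₁ O₂).map_smul c a

theorem inr_smul (c : F) (b : O₂) : inr F O₁ O₂ (c • b) = c • inr F O₁ O₂ b :=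
  (inrLinear F O₁ O₂).map_smul c b

theorem norm_inl_le (a : O₁) : ‖inl F O₁ O₂ a‖ ≤ ‖(1 : O₂)‖ * ‖a‖ := by
  have := norm_inl_mul_inr_le (F := F) a (1 : O₂)
  rwa [map_one, mul_one, mul_comm] at this

theorem norm_inr_le (b : O₂) : ‖inr F O₁ O₂ b‖ ≤ ‖(1 : O₁)‖ * ‖b‖ := by
  have := norm_inl_mul_inr_le (F := F) (1 : O₁) b
  rwa [map_one, one_mul] at this

theorem continuous_inl : Continuous (inl F O₁ O₂) :=
  AddMonoidHomClass.continuous_of_bound (inl F O₁ O₂) _ norm_inl_le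

theorem continuous_inr : Continuous (inr F O₁ O₂) :=
  AddMonoidHomClass.continuous_of_bound (inr F O₁ O₂) _ norm_inr_le

/-- Allows two unconditionally convergent series to be multiplied term by term in
`hasSum_inl_mul_inr`. -/
instance : NonarchimedeanRing (CTensor F O₁ O₂) where
  is_nonarchimedean := NonarchimedeanAddGroup.is_nonarchimedean

/-- Functions on a two-element set, as pairs of functions on a point. -/
def finTwoEquivUnit (B : Type*) : (Fin 2 → B) ≃ (Unit → B) × (Unit → B) :=
  (finTwoArrowEquiv B).trans
    ((Equiv.funUnique Unit B).symm.prodCongr (Equiv.funUnique Unit B).symm)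

theorem hasSum_inl_mul_inr {B : Type*} {f : (Unit → B) → O₁} {g : (Unit → B) → O₂} {a : O₁}
    {b : O₂} (hf : HasSum f a) (hg : HasSum g b) :
    HasSum (fun q : Fin 2 → B => inl F O₁ O₂ (f fun _ => q 0) * inr F O₁ O₂ (g fun _ => q 1))
      (inl F O₁ O₂ a * inr F O₁ O₂ b) :=
  (finTwoEquivUnit B).hasSum_iff.2 ((hf.map (inl F O₁ O₂) continuous_inl).mul_of_nonarchimedean
    (hg.map (inr F O₁ O₂) continuous_inr))

theorem polyBallPow_eq_mul {n : ℕ} (q : Fin 2 → ZMod (p ^ n) × ℕ) (y : Fin 2 → ℤ_[p]) :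
    polyBallPow n q y = polyBallPow (R := Unit) n (fun _ => q 0) (fun _ => y 0) *
      polyBallPow (R := Unit) n (fun _ => q 1) (fun _ => y 1) := by
  simp [polyBallPow]

/-- The monomials in two variables factor, so multiplying the two series gives the expansion with
the external products as coefficients. -/
theorem IsExpansion.inl_mul_inr {n : ℕ} {c : (Unit → ZMod (p ^ n) × ℕ) → O₁}
    {d : (Unit → ZMod (p ^ n) × ℕ) → O₂} {f : (Unit → ℤ_[p]) → O₁} {g : (Unit → ℤ_[p]) → O₂}
    (hf : IsExpansion F n c f) (hg : IsExpansion F n d g) :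
    IsExpansion F n (fun q : Fin 2 → ZMod (p ^ n) × ℕ =>
        inl F O₁ O₂ (c fun _ => q 0) * inr F O₁ O₂ (d fun _ => q 1))
      (fun y : Fin 2 → ℤ_[p] => inl F O₁ O₂ (f fun _ => y 0) * inr F O₁ O₂ (g fun _ => y 1)) := by
  refine ⟨?_, fun y => ?_⟩
  · have hc := hf.1
    have hd := hg.1
    obtain ⟨M, hM⟩ := exists_norm_le_of_tendsto_zero hd
    have h1 : Tendsto (fun u : (Unit → ZMod (p ^ n) × ℕ) × (Unit → ZMod (p ^ n) × ℕ) =>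
        inl F O₁ O₂ (c u.1) * inr F O₁ O₂ (d u.2)) cofinite (𝓝 0) := by
      refine tendsto_cofinite_prod_zero (C := fun q => ‖c q‖ * M) ?_ (fun q q' => ?_) fun q => ?_
      · simpa using (tendsto_zero_iff_norm_tendsto_zero.1 hc).mul_const M
      · exact (norm_inl_mul_inr_le _ _).trans (by gcongr; exact hM q')
      · refine squeeze_zero_norm (fun q' => norm_inl_mul_inr_le _ _) ?_
        simpa using (tendsto_zero_iff_norm_tendsto_zero.1 hd).const_mul ‖c q‖
    exact h1.comp (f := finTwoEquivUnit (ZMod (p ^ n) × ℕ))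
      (finTwoEquivUnit (ZMod (p ^ n) × ℕ)).injective.tendsto_cofinite
  · have h₁ : HasSum (fun q : Unit → ZMod (p ^ n) × ℕ => algebraMap ℚ_[p] F
        (polyBallPow n q fun _ => y 0) • c q) (f fun _ => y 0) := hf.2 _
    have h₂ : HasSum (fun q : Unit → ZMod (p ^ n) × ℕ => algebraMap ℚ_[p] F
        (polyBallPow n q fun _ => y 1) • d q) (g fun _ => y 1) := hg.2 _
    have := hasSum_inl_mul_inr (F := F) (B := ZMod (p ^ n) × ℕ) h₁ h₂
    have e : ∀ q : Fin 2 → ZMod (p ^ n) × ℕ, algebraMap ℚ_[p] F (polyBallPow n q y) •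
        (inl F O₁ O₂ (c fun _ => q 0) * inr F O₁ O₂ (d fun _ => q 1)) = _ := fun q => by
      rw [polyBallPow_eq_mul, map_mul, ← smul_mul_smul_comm, ← inl_smul, ← inr_smul]
    simpa only [e] using this

section Weights

variable (k : Weight (p := p) F O₁) (k₁ : Weight (p := p) F O₁) (k₂ : Weight (p := p) F O₂)

theorem Weight.isAnalyticChar_single : IsAnalyticChar F k.single := by
  obtain ⟨n, C, hC, h⟩ := k.analytic
  refine ⟨n, C, hC, fun x => ?_⟩
  obtain ⟨c, hc, hcC, hs⟩ := h (x ())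
  exact ⟨c, hc, hcC, fun z y hz hy => hs z (y ()) hz fun i => hy i⟩

theorem isAnalyticChar_boxplus [CompleteSpace O₁] [IsUltrametricDist O₁] [CompleteSpace O₂]
    [IsUltrametricDist O₂] : IsAnalyticChar F (boxplus k₁ k₂) := by
  obtain ⟨n₁, C₁, h₁⟩ := k₁.analytic
  obtain ⟨n₂, C₂, h₂⟩ := k₂.analytic
  replace h₁ := h₁.mono_order (le_max_left n₁ n₂)
  replace h₂ := h₂.mono_order (le_max_right n₁ n₂)
  refine ⟨max n₁ n₂, (‖(1 : O₂)‖ * C₁) * (‖(1 : O₁)‖ * C₂), ?_⟩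
  refine hasExpansions_of_hasTate (mul_nonneg (mul_nonneg (norm_nonneg _) h₁.1)
    (mul_nonneg (norm_nonneg _) h₂.1)) fun x => ?_
  obtain ⟨G₁, hG₁, e₁⟩ := h₁.exists_hasTate (x 0)
  obtain ⟨G₂, hG₂, e₂⟩ := h₂.exists_hasTate (x 1)
  have t₁ := (hG₁.comp (ι := Fin 2) (h := fun _ z => z 0) fun _ => hasTate_coord 0).map
    (inlLinear F O₁ O₂) norm_inl_le (norm_nonneg _)
  have t₂ := (hG₂.comp (ι := Fin 2) (h := fun _ z => z 1) fun _ => hasTate_coord 1).map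
    (inrLinear F O₁ O₂) norm_inr_le (norm_nonneg _)
  refine ⟨_, t₁.mul t₂, fun z y hz hy => ?_⟩
  change inl F O₁ O₂ (k₁.char (y 0)) * inr F O₁ O₂ (k₂.char (y 1)) = _
  rw [e₁ (fun _ => z 0) (y 0) (fun _ => hz 0) fun _ => hy 0,
    e₂ (fun _ => z 1) (y 1) (fun _ => hz 1) fun _ => hy 1]
  rfl

end Weights

/-! ### Existence and uniqueness of the product distribution -/

variable [CompleteSpace O₁] [IsUltrametricDist O₁] [CompleteSpace O₂] [IsUltrametricDist O₂]
  {k₁ : Weight (p := p) F O₁} {k₂ : Weight (p := p) F O₂} {n m : ℕ}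
  (μ₁ : Distr F (W p Unit) k₁.single) (μ₂ : Distr F (W p Unit) k₂.single)

/-- The values of `μ₁ ⊗ μ₂` at the functions `polyBallPow n q`. -/
def prodValue (n : ℕ) (q : Fin 2 → ZMod (p ^ n) × ℕ) : CTensor F O₁ O₂ :=
  inl F O₁ O₂ (μ₁.1 (basisFun k₁.isAnalyticChar_single n fun _ => q 0)) *
    inr F O₁ O₂ (μ₂.1 (basisFun k₂.isAnalyticChar_single n fun _ => q 1))

theorem exists_norm_prodValue_le (n : ℕ) : ∃ M, ∀ q, ‖prodValue μ₁ μ₂ n q‖ ≤ M := by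
  obtain ⟨M₁, h₁, hM₁⟩ := Distr.exists_slice_bound k₁.isAnalyticChar_single μ₁ n
  obtain ⟨M₂, h₂, hM₂⟩ := Distr.exists_slice_bound k₂.isAnalyticChar_single μ₂ n
  refine ⟨(M₁ * ‖(1 : O₁)‖) * (M₂ * ‖(1 : O₂)‖), fun q => (norm_inl_mul_inr_le _ _).trans ?_⟩
  refine mul_le_mul (hM₁ _ _ ?_) (hM₂ _ _ ?_) (norm_nonneg _) (by positivity) <;>
  · simp only [basisFun_slice]
    exact hasExpansions_polyBallPow _

variable {μ₁ μ₂}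

/-- Expand `f₁` and `f₂`, apply `Distr.hasSum` to each, and multiply the two series. -/
theorem isValue_prodValue {f₁ : HomFun F (W p Unit) k₁.single}
    {f₂ : HomFun F (W p Unit) k₂.single} {f : HomFun F (W p (Fin 2)) (boxplus k₁ k₂)} {C₁ C₂ : ℝ}
    (h₁ : HasExpansions F chartZ n C₁ (fun y => f₁.1 (slice y)))
    (h₂ : HasExpansions F chartZ n C₂ (fun y => f₂.1 (slice y)))
    (hf : ∀ y, f.1 (slice y) =
      inl F O₁ O₂ (f₁.1 (slice fun _ => y 0)) * inr F O₁ O₂ (f₂.1 (slice fun _ => y 1))) :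
    IsValue (prodValue μ₁ μ₂ n) f (inl F O₁ O₂ (μ₁.1 f₁) * inr F O₁ O₂ (μ₂.1 f₂)) := by
  obtain ⟨c₁, hc₁, -⟩ := h₁.exists_isExpansion
  obtain ⟨c₂, hc₂, -⟩ := h₂.exists_isExpansion
  refine ⟨_, by simpa only [hf] using IsExpansion.inl_mul_inr hc₁ hc₂, ?_⟩
  convert hasSum_inl_mul_inr (F := F) (Distr.hasSum k₁.isAnalyticChar_single μ₁ hc₁)
    (Distr.hasSum k₂.isAnalyticChar_single μ₂ hc₂) using 2 with q
  rw [prodValue, map_mul, map_mul, mul_mul_mul_comm]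

theorem basisFun_boxplus_slice (q : Fin 2 → ZMod (p ^ n) × ℕ) (y : Fin 2 → ℤ_[p]) :
    (basisFun (isAnalyticChar_boxplus k₁ k₂) n q).1 (slice y) = inl F O₁ O₂
      ((basisFun k₁.isAnalyticChar_single n fun _ => q 0).1 (slice fun _ => y 0)) *
      inr F O₁ O₂ ((basisFun k₂.isAnalyticChar_single n fun _ => q 1).1 (slice fun _ => y 1)) := by
  rw [basisFun_slice, basisFun_slice, basisFun_slice, inl_smul, inr_smul, smul_mul_smul_comm,
    ← map_mul, ← polyBallPow_eq_mul, map_one, map_one, one_mul]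

/-- Consistency of the functionals attached to different orders. A monomial of order `n` is a pure
tensor of functions that also have order `m`, so `isValue_prodValue` evaluates it at order `m` with
the same result. A general `f` is a limit of finite combinations of such monomials, also in the norm
of order `m`. -/
theorem IsValue.mono_order {f : HomFun F (W p (Fin 2)) (boxplus k₁ k₂)} {v : CTensor F O₁ O₂}
    (h : IsValue (prodValue μ₁ μ₂ n) f v) (hnm : n ≤ m) : IsValue (prodValue μ₁ μ₂ m) f v := by
  have hbox := isAnalyticChar_boxplus k₁ k₂
  obtain ⟨c, hc, hs⟩ := h
  obtain ⟨M, hM⟩ := exists_norm_prodValue_le μ₁ μ₂ m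
  have hM0 : 0 ≤ M := (norm_nonneg _).trans (hM fun _ => (0, 0))
  have hbasis : ∀ q : Fin 2 → ZMod (p ^ n) × ℕ,
      IsValue (prodValue μ₁ μ₂ m) (basisFun hbox n q) (prodValue μ₁ μ₂ n q) := fun q => by
    refine isValue_prodValue (C₁ := ‖(1 : O₁)‖) (C₂ := ‖(1 : O₂)‖) ?_ ?_ (basisFun_boxplus_slice q)
    all_goals
      simp only [basisFun_slice]
      exact (hasExpansions_polyBallPow _).mono_order hnm
  have happrox : ∀ ε > 0, ∃ v', IsValue (prodValue μ₁ μ₂ m) f v' ∧ ‖v' - v‖ ≤ ε := fun ε hε => by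
    obtain ⟨S₁, hS₁⟩ := hc.exists_finset (ε := ε / (M + 1)) (by positivity)
    obtain ⟨S₂, hS₂⟩ := hasSum_iff_eventually.1 hs ε hε
    classical
    have e₁ := hS₁ (S₁ ∪ S₂) Finset.subset_union_left
    have e₂ := hS₂ (S₁ ∪ S₂) Finset.subset_union_right
    obtain ⟨w, hw, hwε⟩ := exists_isValue (f := f - ∑ q ∈ S₁ ∪ S₂, c q • basisFun hbox n q) hM
      (by simpa only [sub_sum_basisFun_slice] using e₁.mono_order hnm)
    have h1 := hw.add (IsValue.sum (S₁ ∪ S₂) fun q => (hbasis q).smul (c q))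
    rw [sub_add_cancel] at h1
    refine ⟨_, h1, ?_⟩
    rw [add_sub_assoc]
    refine (IsUltrametricDist.norm_add_le_max _ _).trans (max_le (hwε.trans ?_) e₂.le)
    rw [div_mul_eq_mul_div, div_le_iff₀ (by positivity)]
    nlinarith
  obtain ⟨v₁, hv₁, -⟩ := happrox 1 one_pos
  -- At order `m` the value is unique, so every approximation produced by `happrox` is the same
  -- `v₁`.
  have : v₁ = v := by
    refine eq_of_sub_eq_zero (norm_le_zero_iff.1 (le_of_forall_pos_le_add fun ε hε => ?_))
    obtain ⟨v', hv', hε'⟩ := happrox ε hε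
    rw [zero_add, hv₁.unique hv']
    exact hε'
  exact this ▸ hv₁

theorem isValue_unique_of_order {f : HomFun F (W p (Fin 2)) (boxplus k₁ k₂)}
    {v v' : CTensor F O₁ O₂} (h : IsValue (prodValue μ₁ μ₂ n) f v)
    (h' : IsValue (prodValue μ₁ μ₂ m) f v') : v = v' :=
  (h.mono_order (le_max_left n m)).unique (h'.mono_order (le_max_right n m))

variable (μ₁ μ₂)

theorem exists_order_isValue (f : HomFun F (W p (Fin 2)) (boxplus k₁ k₂)) :
    ∃ v n, IsValue (prodValue μ₁ μ₂ n) f v := by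
  obtain ⟨⟨n, C, hf⟩, -⟩ := f.2
  obtain ⟨M, hM⟩ := exists_norm_prodValue_le μ₁ μ₂ n
  obtain ⟨v, hv, -⟩ := exists_isValue hM hf.comp_slice
  exact ⟨v, n, hv⟩

/-- The product `μ₁ ⊗ μ₂` of two distributions on `W`. -/
def prodDistr : Distr F (W p (Fin 2)) (boxplus k₁ k₂) :=
  ⟨{ toFun f := (exists_order_isValue μ₁ μ₂ f).choose
     map_add' f g := by
      obtain ⟨n, hf⟩ := (exists_order_isValue μ₁ μ₂ f).choose_spec
      obtain ⟨m, hg⟩ := (exists_order_isValue μ₁ μ₂ g).choose_spec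
      obtain ⟨l, hfg⟩ := (exists_order_isValue μ₁ μ₂ (f + g)).choose_spec
      exact isValue_unique_of_order hfg ((hf.mono_order (le_max_left n m)).add
        (hg.mono_order (le_max_right n m)))
     map_smul' a f := by
      obtain ⟨n, hf⟩ := (exists_order_isValue μ₁ μ₂ f).choose_spec
      obtain ⟨l, haf⟩ := (exists_order_isValue μ₁ μ₂ (a • f)).choose_spec
      exact isValue_unique_of_order haf (hf.smul a) }, fun n => by
    obtain ⟨M, hM⟩ := exists_norm_prodValue_le μ₁ μ₂ n
    refine ⟨M, fun f C hf => ?_⟩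
    obtain ⟨v, hv, hvC⟩ := exists_isValue hM hf.comp_slice
    obtain ⟨m, hf⟩ := (exists_order_isValue μ₁ μ₂ f).choose_spec
    rw [mul_comm]
    exact (congrArg norm (isValue_unique_of_order hf hv)).trans_le hvC⟩

variable {μ₁ μ₂}

theorem prodDistr_apply {f : HomFun F (W p (Fin 2)) (boxplus k₁ k₂)} {v : CTensor F O₁ O₂}
    (h : IsValue (prodValue μ₁ μ₂ n) f v) : (prodDistr μ₁ μ₂).1 f = v := by
  obtain ⟨m, hf⟩ := (exists_order_isValue μ₁ μ₂ f).choose_spec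
  exact isValue_unique_of_order hf h

theorem isProduct_prodDistr : IsProduct μ₁ μ₂ (prodDistr μ₁ μ₂) := by
  intro f₁ f₂ f hf
  obtain ⟨⟨n₁, C₁, h₁⟩, -⟩ := f₁.2
  obtain ⟨⟨n₂, C₂, h₂⟩, -⟩ := f₂.2
  exact prodDistr_apply (isValue_prodValue (h₁.comp_slice.mono_order (le_max_left n₁ n₂))
    (h₂.comp_slice.mono_order (le_max_right n₁ n₂)) fun y => hf (slice y))

/-- A factorization on the section spreads to all of `W × W` because `k₁ ⊞ k₂` factors in the same
way. -/
theorem component_extendHom {g : (Fin 2 → ℤ_[p]) → CTensor F O₁ O₂} {g₁ : (Unit → ℤ_[p]) → O₁}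
    {g₂ : (Unit → ℤ_[p]) → O₂}
    (h : ∀ y, g y = inl F O₁ O₂ (g₁ fun _ => y 0) * inr F O₁ O₂ (g₂ fun _ => y 1))
    (w : W p (Fin 2)) : extendHom (boxplus k₁ k₂) g w =
      inl F O₁ O₂ (extendHom k₁.single g₁ (component 0 w)) *
        inr F O₁ O₂ (extendHom k₂.single g₂ (component 1 w)) := by
  rw [extendHom, extendHom, extendHom, map_mul, map_mul, h, mul_mul_mul_comm]
  rfl

/-- The functions `basisFun` on `W × W` are pure tensors, so being a product fixes `μ` on them, and
`Distr.hasSum` extends this to every `f`. Later identities of product distributions need only be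
tested on pure tensors. -/
theorem isProduct_iff {μ : Distr F (W p (Fin 2)) (boxplus k₁ k₂)} :
    IsProduct μ₁ μ₂ μ ↔ μ = prodDistr μ₁ μ₂ := by
  refine ⟨fun h => ?_, fun h => h ▸ isProduct_prodDistr⟩
  refine Subtype.ext (LinearMap.ext fun f => ?_)
  have hbox := isAnalyticChar_boxplus k₁ k₂
  obtain ⟨⟨n, C, hf⟩, -⟩ := f.2
  obtain ⟨c, hc, -⟩ := hf.comp_slice.exists_isExpansion
  refine (prodDistr_apply ⟨c, hc, ?_⟩).symm
  have hs := Distr.hasSum hbox μ hc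
  have e : ∀ q, μ.1 (basisFun hbox n q) = prodValue μ₁ μ₂ n q := fun q => by
    refine h _ _ _ fun w => ?_
    refine component_extendHom
      (g := fun y => algebraMap ℚ_[p] F (polyBallPow n q y) • (1 : CTensor F O₁ O₂))
      (g₁ := fun y => algebraMap ℚ_[p] F (polyBallPow n (fun _ => q 0) y) • (1 : O₁))
      (g₂ := fun y => algebraMap ℚ_[p] F (polyBallPow n (fun _ => q 1) y) • (1 : O₂))
      (fun y => ?_) w
    simpa only [basisFun_slice] using basisFun_boxplus_slice (k₁ := k₁) (k₂ := k₂) q y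
  simpa only [e] using hs

end Product

/-! ### The action of `Σ₀(pℤ_p) ^ R` -/

section Action

variable {p : ℕ} [Fact p.Prime] {F : Type*} [NormedField F] [NormedAlgebra ℚ_[p] F]
  {O : Type*} [NormedCommRing O] [NormedAlgebra F O]
  {R : Type*} [Fintype R] {κ : (R → ℤ_[p]ˣ) →* Oˣ} {n : ℕ} {C : ℝ}

/-- The action of `Σ₀(pℤ_p) ^ R` on `W ^ R`, component by component. -/
def actRows (g : R → Sigma0 p) (w : W p R) : W p R :=
  ⟨fun r => (actW (g r) w).1 r, fun r => (actW (g r) w).2 r⟩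

theorem actW_apply (g : Sigma0 p) (w : W p R) (r : R) (j : Fin 2) :
    (actW g w).1 r j = w.1 r 0 * g.1.1 0 j + w.1 r 1 * g.1.1 1 j := by
  simp only [actW, Matrix.mul_apply, Fin.sum_univ_two]

theorem actRows_apply (g : R → Sigma0 p) (w : W p R) (r : R) (j : Fin 2) :
    (actRows g w).1 r j = w.1 r 0 * (g r).1.1 0 j + w.1 r 1 * (g r).1.1 1 j :=
  actW_apply _ w r j

variable [CompleteSpace O] [IsUltrametricDist O]

theorem HasExpansions.comp_actRows {f : W p R → O}
    (hf : HasExpansions F (chart (W p R)) n C f) (g : R → Sigma0 p) :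
    HasExpansions F (chart (W p R)) n C (fun w => f (actRows g w)) := by
  classical
  refine hf.comp_linear (fun i j => if j.1 = i.1 then (g i.1).1.1 j.2 i.2 else 0) (fun i j => ?_)
    (actRows g) fun w i => ?_
  · split_ifs
    · exact (g i.1).2.1 _ _
    · simp
  · rw [Fintype.sum_prod_type, Finset.sum_eq_single i.1]
    · simp only [chart, actRows_apply, if_true, Fin.sum_univ_two, mul_comm]
    · intro r _ hr
      simp [hr]
    · simp

/-- The action of `Σ₀(pℤ_p) ^ R` on `𝒜_κ(W ^ R)`. -/
def pullRows (g : R → Sigma0 p) : HomFun F (W p R) κ →ₗ[O] HomFun F (W p R) κ where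
  toFun f := ⟨fun w => f.1 (actRows g w), by
    obtain ⟨⟨n, C, hf⟩, hf'⟩ := f.2
    refine ⟨⟨n, C, hf.comp_actRows g⟩, fun t w w' h => hf' t _ _ fun r j => ?_⟩
    rw [actRows_apply, actRows_apply, h, h]
    ring⟩
  map_add' _ _ := rfl
  map_smul' _ _ := rfl

/-- The action of `Σ₀(pℤ_p) ^ R` on distributions on `W ^ R`. -/
def actDRows (μ : Distr F (W p R) κ) (g : R → Sigma0 p) : Distr F (W p R) κ :=
  ⟨μ.1 ∘ₗ pullRows g, fun n => by
    obtain ⟨M, hM⟩ := μ.2 n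
    exact ⟨M, fun f C hf => hM _ C (hf.comp_actRows g)⟩⟩

theorem actDRows_const (μ : Distr F (W p R) κ) (g : Sigma0 p) :
    actDRows μ (fun _ => g) = actD μ g := rfl

theorem actD_mul (μ : Distr F (W p R) κ) (g h : Sigma0 p) :
    actD μ (g * h) = actD (actD μ g) h := by
  refine Subtype.ext (LinearMap.ext fun f => congrArg μ.1 (Subtype.ext (funext fun w => ?_)))
  refine congrArg f.1 (Subtype.ext ?_)
  exact (Matrix.mul_assoc w.1 g.1.1 h.1.1).symm

variable {O₁ O₂ : Type*} [NormedCommRing O₁] [NormedAlgebra F O₁] [NormedCommRing O₂]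
  [NormedAlgebra F O₂] [CompleteSpace O₁] [IsUltrametricDist O₁] [CompleteSpace O₂]
  [IsUltrametricDist O₂] {k₁ : Weight (p := p) F O₁} {k₂ : Weight (p := p) F O₂}
  {μ₁ ν₁ : Distr F (W p Unit) k₁.single} {μ₂ ν₂ : Distr F (W p Unit) k₂.single}
  {μ ν : Distr F (W p (Fin 2)) (boxplus k₁ k₂)}

/-- Acting on the rows separately carries pure tensors to pure tensors. Different matrices on the
two rows are needed for the off-diagonal terms of the double Hecke sum. -/
theorem IsProduct.actDRows (h : IsProduct μ₁ μ₂ μ) (g : Fin 2 → Sigma0 p) :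
    IsProduct (actD μ₁ (g 0)) (actD μ₂ (g 1)) (actDRows μ g) := fun f₁ f₂ f hf =>
  h (pull (g 0) f₁) (pull (g 1) f₂) (pullRows g f) fun w => hf (actRows g w)

theorem IsProduct.actD (h : IsProduct μ₁ μ₂ μ) (g : Sigma0 p) :
    IsProduct (actD μ₁ g) (actD μ₂ g) (actD μ g) :=
  h.actDRows fun _ => g

theorem prodDistr_smul_smul (a₁ : O₁) (a₂ : O₂) : prodDistr (a₁ • μ₁) (a₂ • μ₂)
    = (inl F O₁ O₂ a₁ * inr F O₁ O₂ a₂) • prodDistr μ₁ μ₂ := by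
  refine (isProduct_iff.1 fun f₁ f₂ f hf => ?_).symm
  change (inl F O₁ O₂ a₁ * inr F O₁ O₂ a₂) * (prodDistr μ₁ μ₂).1 f =
    inl F O₁ O₂ (a₁ * μ₁.1 f₁) * inr F O₁ O₂ (a₂ * μ₂.1 f₂)
  rw [isProduct_prodDistr f₁ f₂ f hf, map_mul, map_mul, mul_mul_mul_comm]

theorem sum_distr_apply {X : Set (Matrix R (Fin 2) ℚ_[p])} {J : Type*} (S : Finset J)
    (ν : J → Distr F X κ) (f : HomFun F X κ) :
    (∑ j ∈ S, ν j).1 f = ∑ j ∈ S, (ν j).1 f := by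
  rw [Submodule.coe_sum, LinearMap.sum_apply]

theorem prodDistr_sum_sum {J : Type*} (S : Finset J) (ν₁ : J → Distr F (W p Unit) k₁.single)
    (ν₂ : J → Distr F (W p Unit) k₂.single) :
    prodDistr (∑ j ∈ S, ν₁ j) (∑ j ∈ S, ν₂ j) =
      ∑ i ∈ S, ∑ j ∈ S, prodDistr (ν₁ i) (ν₂ j) := by
  refine (isProduct_iff.1 fun f₁ f₂ f hf => ?_).symm
  rw [sum_distr_apply, sum_distr_apply, sum_distr_apply, map_sum, map_sum, Finset.sum_mul_sum]
  refine Finset.sum_congr rfl fun i _ => ?_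
  rw [sum_distr_apply]
  exact Finset.sum_congr rfl fun j _ => isProduct_prodDistr f₁ f₂ f hf

end Action

/-! ### The operator `U_p` -/

section Hecke

variable {p : ℕ} [Fact p.Prime]

/-- The matrix `(1 j; 0 p)`. -/
def heckeMatrix (j : ℕ) : GL (Fin 2) ℚ_[p] :=
  Matrix.GeneralLinearGroup.mkOfDetNeZero !![1, (j : ℚ_[p]); 0, (p : ℚ_[p])]
    (by simpa [Matrix.det_fin_two] using (Fact.out : p.Prime).ne_zero)

theorem coe_heckeMatrix (j : ℕ) :
    (heckeMatrix j : GL (Fin 2) ℚ_[p]).1 = !![1, (j : ℚ_[p]); 0, (p : ℚ_[p])] := rfl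

theorem norm_natCast_le_one (j : ℕ) : ‖(j : ℚ_[p])‖ ≤ 1 := by
  have h := PadicInt.norm_le_one (j : ℤ_[p])
  rwa [PadicInt.norm_def, PadicInt.coe_natCast] at h

theorem padicNorm_sub_le_max (x y : ℚ_[p]) : ‖x - y‖ ≤ max ‖x‖ ‖y‖ := by
  rw [sub_eq_add_neg, ← norm_neg y]
  exact IsUltrametricDist.norm_add_le_max _ _

theorem heckeMatrix_mem (j : ℕ) : heckeMatrix j ∈ Sigma0 p := by
  refine ⟨fun i k => ?_, ?_, ?_⟩ <;> rw [coe_heckeMatrix]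
  · fin_cases i <;> fin_cases k
    · simp
    · exact norm_natCast_le_one j
    · simp
    · exact norm_natCast_le_one p
  · simp
  · simp

variable (p) in
/-- The matrix `(1 j; 0 p)`, as an element of `Σ₀(pℤ_p)`. -/
def heckeElt (j : ℕ) : Sigma0 p := ⟨heckeMatrix j, heckeMatrix_mem j⟩

theorem exists_norm_sub_natCast_lt {x : ℚ_[p]} (hx : ‖x‖ ≤ 1) :
    ∃ j : Fin p, ∃ y : ℚ_[p], ‖y‖ ≤ 1 ∧ x - (j : ℕ) = p * y := by
  obtain ⟨j, hj, h⟩ := PadicInt.exists_mem_range (⟨x, hx⟩ : ℤ_[p])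
  rw [IsLocalRing.mem_maximalIdeal, PadicInt.mem_nonunits, PadicInt.norm_lt_one_iff_dvd] at h
  obtain ⟨y, hy⟩ := h
  refine ⟨⟨j, hj⟩, y, y.norm_le_one, ?_⟩
  have := congrArg (fun u : ℤ_[p] => (u : ℚ_[p])) hy
  push_cast at this
  exact this

/-- For `γ = (a b; c d)` the first row of `(1 0; 0 p) γ` is `(a, b)`, and `j` is the residue of `b /
a` modulo `p`, which exists because `a` is a unit. -/
theorem exists_mul_heckeMatrix {γ : GL (Fin 2) ℚ_[p]} (hγ : γ ∈ Gamma0 p) :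
    ∃ j : Fin p, ∃ δ ∈ Gamma0 p, heckeMatrix 0 * γ = δ * heckeMatrix j := by
  obtain ⟨⟨hint, ha, hc⟩, hdet⟩ := hγ
  have ha0 : γ.1 0 0 ≠ 0 := fun h => by simp [h] at ha
  have hp0 : (p : ℚ_[p]) ≠ 0 := by exact_mod_cast (Fact.out : p.Prime).ne_zero
  obtain ⟨j, y, hy, hj⟩ := exists_norm_sub_natCast_lt (p := p) (x := γ.1 0 1 / γ.1 0 0)
    (by rw [norm_div, ha, div_one]; exact hint 0 1)
  have hj' : γ.1 0 1 - (j : ℕ) * γ.1 0 0 = p * (y * γ.1 0 0) := by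
    field_simp at hj
    linear_combination hj
  -- The product `(1 0; 0 p) γ (1 j; 0 p)⁻¹`; its upper right entry `(b - j a) / p` is `y a`,
  -- integral by the choice of `j`.
  let M : Matrix (Fin 2) (Fin 2) ℚ_[p] :=
    !![γ.1 0 0, y * γ.1 0 0; p * γ.1 1 0, γ.1 1 1 - γ.1 1 0 * (j : ℕ)]
  have hMdet : M.det = γ.1.det := by
    rw [Matrix.det_fin_two, Matrix.det_fin_two]
    simp only [M, Matrix.of_apply, Matrix.cons_val', Matrix.cons_val_zero, Matrix.cons_val_one,
      Matrix.cons_val_fin_one]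
    linear_combination γ.1 1 0 * hj'
  have hM0 : M.det ≠ 0 := fun h => by rw [← hMdet, h] at hdet; simp at hdet
  refine ⟨j, Matrix.GeneralLinearGroup.mkOfDetNeZero M hM0, ⟨⟨fun r s => ?_, ha, ?_⟩, ?_⟩, ?_⟩
  · change ‖M r s‖ ≤ 1
    fin_cases r <;> fin_cases s
    · exact ha.le
    · simpa [M, ha] using hy
    · simpa [M] using mul_le_one₀ (norm_natCast_le_one (p := p) p) (norm_nonneg _) (hint 1 0)
    · refine (padicNorm_sub_le_max _ _).trans (max_le (hint 1 1) ?_)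
      rw [norm_mul]
      exact mul_le_one₀ (hint 1 0) (norm_nonneg _) (norm_natCast_le_one _)
  · change ‖(p : ℚ_[p]) * γ.1 1 0‖ < 1
    rw [norm_mul]
    exact lt_of_le_of_lt (mul_le_of_le_one_left (norm_nonneg _) (norm_natCast_le_one p)) hc
  · change ‖M.det‖ = 1
    rw [hMdet, hdet]
  · refine Units.ext ?_
    change (!![1, ((0 : ℕ) : ℚ_[p]); 0, (p : ℚ_[p])] : Matrix (Fin 2) (Fin 2) ℚ_[p]) * γ.1
      = M * !![1, ((j : ℕ) : ℚ_[p]); 0, (p : ℚ_[p])]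
    ext r s
    rw [Matrix.mul_apply, Matrix.mul_apply, Fin.sum_univ_two, Fin.sum_univ_two]
    fin_cases r <;> fin_cases s
    · simp [M]
    · simp only [M, Fin.zero_eta, Fin.mk_one, Matrix.of_apply, Matrix.cons_val', Matrix.cons_val_zero,
        Matrix.cons_val_one, Matrix.cons_val_fin_one]
      push_cast
      linear_combination hj'
    · simp [M]
    · simp only [M, Fin.mk_one, Matrix.of_apply, Matrix.cons_val', Matrix.cons_val_zero,
        Matrix.cons_val_one, Matrix.cons_val_fin_one]
      ring

theorem norm_natCast_sub_lt_one_iff {i j : Fin p} :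
    ‖((i : ℕ) : ℚ_[p]) - (j : ℕ)‖ < 1 ↔ i = j := by
  refine ⟨fun h => ?_, fun h => by simp [h]⟩
  have h1 : ((i : ℕ) : ℚ_[p]) - (j : ℕ) = (((i : ℕ) : ℤ) - ((j : ℕ) : ℤ) : ℤ) := by push_cast; rfl
  rw [h1, Padic.norm_intCast_lt_one_iff] at h
  have := Int.eq_zero_of_abs_lt_dvd h (by rw [abs_lt]; omega)
  exact Fin.ext (by omega)

/-- Comparing first rows gives `δ₀₀ = 1` and `i - j = p δ₀₁`, so `i` and `j` agree modulo `p`. -/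
theorem heckeMatrix_injective {i j : Fin p} {δ : GL (Fin 2) ℚ_[p]} (hδ : δ ∈ Gamma0 p)
    (h : heckeMatrix i = δ * heckeMatrix j) : i = j := by
  have h1 := congrArg (fun g : GL (Fin 2) ℚ_[p] => g.1 0) h
  have h2 : ∀ s, (heckeMatrix i : GL (Fin 2) ℚ_[p]).1 0 s =
      δ.1 0 0 * (heckeMatrix j : GL (Fin 2) ℚ_[p]).1 0 s +
        δ.1 0 1 * (heckeMatrix j : GL (Fin 2) ℚ_[p]).1 1 s := fun s => by
    rw [congrFun h1 s, Units.val_mul, Matrix.mul_apply, Fin.sum_univ_two]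
  have h3 := h2 0
  have h4 := h2 1
  simp only [coe_heckeMatrix, Matrix.of_apply, Matrix.cons_val', Matrix.cons_val_zero,
    Matrix.cons_val_one, Matrix.cons_val_fin_one, mul_one, mul_zero, add_zero] at h3 h4
  rw [← norm_natCast_sub_lt_one_iff, h4, ← h3, one_mul, add_sub_cancel_left, norm_mul]
  exact lt_of_le_of_lt (mul_le_of_le_one_left (norm_nonneg _) (hδ.1.1 0 1)) Padic.norm_p_lt_one

variable {a b : ℚ}

variable (a b) in
/-- The element of `B_f^×` concentrated at `p`, where it is the matrix `(1 j; 0 p)`. -/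
def heckeRep (j : ℕ) : Bf p a b := (1, heckeMatrix j)

theorem heckeRep_zero : heckeRep a b 0 = piHat p a b := by
  refine Prod.ext rfl (Units.ext ?_)
  rw [heckeRep, coe_heckeMatrix, Nat.cast_zero]
  rfl

theorem heckeRep_mem (j : ℕ) : heckeRep a b j ∈ SigmaBf p a b := ⟨trivial, heckeMatrix_mem j⟩

theorem heckeMatrix_eq_zero_mul (j : ℕ) : ∃ γ ∈ Gamma0 p, heckeMatrix j = heckeMatrix 0 * γ := by
  let M : Matrix (Fin 2) (Fin 2) ℚ_[p] := !![1, (j : ℚ_[p]); 0, 1]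
  have hM : M.det = 1 := by simp [M, Matrix.det_fin_two]
  refine ⟨Matrix.GeneralLinearGroup.mkOfDetNeZero M (by simp [hM]),
    ⟨⟨fun r s => ?_, ?_, ?_⟩, ?_⟩, Units.ext ?_⟩
  · change ‖M r s‖ ≤ 1
    fin_cases r <;> fin_cases s
    · simp [M]
    · exact norm_natCast_le_one j
    · simp [M]
    · simp [M]
  · change ‖(1 : ℚ_[p])‖ = 1
    simp
  · change ‖(0 : ℚ_[p])‖ < 1
    simp
  · change ‖M.det‖ = 1
    simp [hM]
  · change (!![1, (j : ℚ_[p]); 0, (p : ℚ_[p])] : Matrix (Fin 2) (Fin 2) ℚ_[p])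
      = !![1, ((0 : ℕ) : ℚ_[p]); 0, (p : ℚ_[p])] * M
    ext r s
    rw [Matrix.mul_apply, Fin.sum_univ_two]
    fin_cases r <;> fin_cases s <;> simp [M]

/-- The cosets in `K \ K π̂_p K`, for `K = K^p Γ₀(pℤ_p)`. -/
def heckeCoset (Kp : Subgroup (BAway p a b)ˣ) (j : Fin p) : Cosets (level Kp) (piHat p a b) :=
  ⟨Quotient.mk _ (heckeRep a b j), heckeRep a b j, by
    obtain ⟨γ, hγ, h⟩ := heckeMatrix_eq_zero_mul (p := p) j
    rw [DoubleCoset.mem_doubleCoset]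
    refine ⟨1, one_mem _, (1, γ), ⟨one_mem _, hγ⟩, ?_⟩
    rw [one_mul, ← heckeRep_zero]
    exact Prod.ext (one_mul _).symm h, rfl⟩

/-- The component away from `p` of any element of the double coset lies in `K^p` and is absorbed on
the left, so the question is one about matrices at `p`. -/
theorem heckeCoset_bijective (Kp : Subgroup (BAway p a b)ˣ) :
    Function.Bijective (heckeCoset Kp) := by
  refine ⟨fun i j h => ?_, ?_⟩
  · have h1 := Quotient.exact (congrArg Subtype.val h)
    have h2 := (QuotientGroup.rightRel_apply.1 h1).2
    exact (heckeMatrix_injective h2 (inv_mul_cancel_right (heckeMatrix (j : ℕ)) _).symm).symm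
  · rintro ⟨c, y, hy, rfl⟩
    obtain ⟨k, hk, k', hk', rfl⟩ := DoubleCoset.mem_doubleCoset.1 hy
    obtain ⟨j, δ, hδ, h⟩ := exists_mul_heckeMatrix hk'.2
    refine ⟨j, Subtype.ext (Quotient.sound (QuotientGroup.rightRel_apply.2 ?_))⟩
    have h1 : k * piHat p a b * k' * (heckeRep a b j)⁻¹ = k * (k'.1, δ) := by
      rw [mul_inv_eq_iff_eq_mul, mul_assoc, mul_assoc, ← heckeRep_zero]
      congr 1
      exact Prod.ext ((one_mul _).trans (mul_one _).symm) h
    rw [h1]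
    exact mul_mem hk ⟨hk'.1, hδ⟩

/-! ### The Hecke operator as an explicit sum -/

variable {F : Type*} [NormedField F] [NormedAlgebra ℚ_[p] F]
  {O : Type*} [NormedCommRing O] [NormedAlgebra F O] [CompleteSpace O] [IsUltrametricDist O]
  {R : Type*} [Fintype R] {κ : (R → ℤ_[p]ˣ) →* Oˣ} {φ : Bf p a b → Distr F (W p R) κ}

theorem slash_mul (φ : Bf p a b → Distr F (W p R) κ) (u v : SigmaBf p a b) :
    slash φ (u * v) = slash (slash φ u) v := by
  funext x
  have h1 := actD_mul (φ (u.1 * (v.1 * x))) ⟨u.1.2, u.2.2⟩ ⟨v.1.2, v.2.2⟩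
  rw [← mul_assoc] at h1
  refine h1.trans ?_
  rw [mul_assoc]
  rfl

/-- As `φ` is fixed by the level, `slash φ` depends only on the left coset `K x`, and the chosen
representatives may be replaced by `heckeRep`. -/
theorem IsFixed.hecke_apply {Kp : Subgroup (BAway p a b)ˣ} (h : IsFixed φ Kp) (x : Bf p a b) :
    hecke Kp piHat_mem φ x
      = ∑ j : Fin p, actD (φ (heckeRep a b j * x)) (heckeElt p j) := by
  have h1 : hecke Kp piHat_mem φ
      = ∑ᶠ j : Fin p, slash φ ⟨heckeRep a b j, heckeRep_mem j⟩ := by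
    refine (finsum_eq_of_bijective _ (heckeCoset_bijective Kp) fun j => ?_).symm
    have h2 := QuotientGroup.rightRel_apply.1 (Quotient.exact (heckeCoset Kp j).2.choose_spec.2)
    have h3 : (heckeCoset Kp j).rep = (heckeRep a b j * (heckeCoset Kp j).rep⁻¹)⁻¹ *
        heckeRep a b j := by group
    have h4 := inv_mem h2
    rw [show (⟨(heckeCoset Kp j).rep, (heckeCoset Kp j).rep_mem piHat_mem⟩ : SigmaBf p a b)
      = ⟨_, level_le Kp h4⟩ * ⟨heckeRep a b j, heckeRep_mem j⟩ from Subtype.ext h3, slash_mul,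
      h _ h4]
  rw [h1, finsum_eq_sum_of_fintype, Finset.sum_apply]
  rfl

/-- The right-hand side does not involve `K^p`, so forms of different levels, and their product, can
be compared. -/
theorem Up_apply (h : ∃ Kp : Subgroup (BAway p a b)ˣ, IsOpen (Kp : Set (BAway p a b)ˣ) ∧
    IsCompact (Kp : Set (BAway p a b)ˣ) ∧ IsFixed φ Kp) (x : Bf p a b) :
    Up φ x = ∑ j : Fin p, actD (φ (heckeRep a b j * x)) (heckeElt p j) := by
  rw [Up, dif_pos h]
  exact h.choose_spec.2.2.hecke_apply x

end Hecke

/-! ### The product of two forms -/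

section ProductForm

variable {p : ℕ} [Fact p.Prime] {a b : ℚ}

/-- Makes compact subgroups of the unit group closed, hence the intersection of two of them compact
in `IsForm.prodForm`. -/
instance : T2Space (BAway p a b) := by
  refine T2Space.of_injective_continuous
    (f := fun x : BAway p a b => ((x.re, x.imI), (x.imJ, x.imK))) (fun x y h => ?_)
    continuous_induced_dom
  simp only [Prod.mk.injEq] at h
  exact QuaternionAlgebra.ext h.1.1 h.1.2 h.2.1 h.2.2

variable {F : Type*} [NormedField F] [NormedAlgebra ℚ_[p] F]
  {O₁ O₂ : Type*} [NormedCommRing O₁] [NormedAlgebra F O₁] [NormedCommRing O₂]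
  [NormedAlgebra F O₂] [CompleteSpace O₁] [IsUltrametricDist O₁] [CompleteSpace O₂]
  [IsUltrametricDist O₂] {k₁ : Weight (p := p) F O₁} {k₂ : Weight (p := p) F O₂}
  {ψ : Bp p a b ≃ₐ[ℚ_[p]] Matrix (Fin 2) (Fin 2) ℚ_[p]}
  {φ₁ : Bf p a b → Distr F (W p Unit) k₁.single} {φ₂ : Bf p a b → Distr F (W p Unit) k₂.single}

variable (φ₁ φ₂) in
/-- The product `φ₁ ⊗ φ₂`. -/
def prodForm (x : Bf p a b) : Distr F (W p (Fin 2)) (boxplus k₁ k₂) := prodDistr (φ₁ x) (φ₂ x)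

theorem IsFixed.mono {O : Type*} [NormedCommRing O] [NormedAlgebra F O] [CompleteSpace O]
    [IsUltrametricDist O] {R : Type*} [Fintype R] {κ : (R → ℤ_[p]ˣ) →* Oˣ}
    {φ : Bf p a b → Distr F (W p R) κ} {Kp Kp' : Subgroup (BAway p a b)ˣ} (h : IsFixed φ Kp)
    (hle : Kp' ≤ Kp) : IsFixed φ Kp' :=
  fun u hu => h u ⟨hle hu.1, hu.2⟩

/-- The translated product is a product of the translated factors, which are unchanged; uniqueness
of the product concludes. -/
theorem IsFixed.prodForm {Kp : Subgroup (BAway p a b)ˣ} (h₁ : IsFixed φ₁ Kp)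
    (h₂ : IsFixed φ₂ Kp) : IsFixed (prodForm φ₁ φ₂) Kp := by
  intro u hu
  funext x
  refine isProduct_iff.1 ?_
  have := (isProduct_prodDistr (μ₁ := φ₁ (u * x)) (μ₂ := φ₂ (u * x))).actD ⟨u.2, hu.2.1⟩
  have e₁ := congrFun (h₁ u hu) x
  have e₂ := congrFun (h₂ u hu) x
  simp only [slash] at e₁ e₂
  rw [e₁, e₂] at this
  exact this

theorem IsForm.prodForm (h₁ : IsForm ψ φ₁) (h₂ : IsForm ψ φ₂) : IsForm ψ (prodForm φ₁ φ₂) := by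
  obtain ⟨i₁, K₁, o₁, c₁, f₁⟩ := h₁
  obtain ⟨i₂, K₂, o₂, c₂, f₂⟩ := h₂
  refine ⟨fun x γ => ?_, K₁ ⊓ K₂, ?_, ?_, ?_⟩
  · rw [QuatForms.prodForm, i₁, i₂]
    rfl
  · rw [Subgroup.coe_inf]
    exact o₁.inter o₂
  · rw [Subgroup.coe_inf]
    exact c₁.inter c₂
  · exact (f₁.mono inf_le_left).prodForm (f₂.mono inf_le_right)

/-! ### Supports of the terms of the double Hecke sum -/

section Support

variable {O : Type*} [NormedCommRing O] [NormedAlgebra F O] {κ : (Fin 2 → ℤ_[p]ˣ) →* Oˣ}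

/-- Removing `i_* μ⁰` amounts to testing `μ` on `f` cut off to the complement of `(W × W)₀`. -/
theorem sub_push0_res0_apply (μ : Distr F (W p (Fin 2)) κ) (f : HomFun F (W p (Fin 2)) κ) :
    (μ - push0 (res0 μ)).1 f = μ.1 (f - extFun (resFun f)) :=
  (map_sub μ.1 f (extFun (resFun f))).symm

theorem sub_extFun_resFun_apply_of_eq (f : HomFun F (W p (Fin 2)) κ) {w : W p (Fin 2)}
    (hw : ‖w.1.det‖ = 1) : (f - extFun (resFun f)).1 w = 0 := by
  change f.1 w - extZero (resFun f).1 w = 0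
  rw [extZero, dif_pos hw]
  exact sub_self _

theorem sub_extFun_resFun_apply_of_ne (f : HomFun F (W p (Fin 2)) κ) {w : W p (Fin 2)}
    (hw : ‖w.1.det‖ ≠ 1) : (f - extFun (resFun f)).1 w = f.1 w := by
  change f.1 w - extZero (resFun f).1 w = f.1 w
  rw [extZero, dif_neg hw, sub_zero]

/-- The determinant is `x₁ x₂ (j - i)` plus an integral multiple of `p`, with `x₁`, `x₂` units and
`i`, `j` taken among `0, …, p - 1`. -/
theorem norm_det_actRows_heckeElt (i j : Fin p) (w : W p (Fin 2)) :
    ‖(actRows ![heckeElt p i, heckeElt p j] w).1.det‖ = 1 ↔ i ≠ j := by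
  have h : (actRows ![heckeElt p i, heckeElt p j] w).1.det =
      w.1 0 0 * w.1 1 0 * (((j : ℕ) : ℚ_[p]) - (i : ℕ)) +
        (w.1 0 0 * w.1 1 1 + -w.1 0 1 * w.1 1 0) * p := by
    have e : ∀ k : ℕ, (heckeElt p k).1.1 = !![1, (k : ℚ_[p]); 0, (p : ℚ_[p])] := fun k => rfl
    rw [Matrix.det_fin_two]
    simp only [actRows_apply, Matrix.cons_val_zero, Matrix.cons_val_one, Matrix.cons_val_fin_one, e,
      Matrix.of_apply, Matrix.cons_val']
    ring
  have hu : ‖w.1 0 0 * w.1 1 0‖ = 1 := by rw [norm_mul, (w.2 0).1, (w.2 1).1, one_mul]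
  have hz : ‖w.1 0 0 * w.1 1 1 + -w.1 0 1 * w.1 1 0‖ ≤ 1 :=
    norm_comb_le (w.2 0).1.le (w.2 1).2 (by rw [norm_neg]; exact (w.2 0).2) (w.2 1).1.le
  rw [h]
  constructor
  · rintro h1 rfl
    rw [sub_self, mul_zero, zero_add, norm_mul] at h1
    exact absurd h1 (lt_of_le_of_lt (mul_le_of_le_one_left (norm_nonneg _) hz)
      Padic.norm_p_lt_one).ne
  · intro hij
    refine norm_comb_eq hu (le_antisymm ?_ (not_lt.1 fun hlt => ?_)) hz Padic.norm_p_lt_one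
    · exact (padicNorm_sub_le_max _ _).trans
        (max_le (norm_natCast_le_one _) (norm_natCast_le_one _))
    · exact hij (norm_natCast_sub_lt_one_iff.1 hlt).symm

variable [CompleteSpace O] [IsUltrametricDist O]

/-- Pulled back by `(u_i, u_j)`, the cut-off function vanishes identically when `i ≠ j` and
coincides with the pull-back of `f` when `i = j`. -/
theorem actDRows_heckeElt_apply (μ : Distr F (W p (Fin 2)) κ) (i j : Fin p)
    (f : HomFun F (W p (Fin 2)) κ) :
    (actDRows μ ![heckeElt p i, heckeElt p j]).1 (f - extFun (resFun f))
      = if i = j then (actD μ (heckeElt p i)).1 f else 0 := by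
  split_ifs with hij
  · subst hij
    have hc : (fun _ => heckeElt p i : Fin 2 → Sigma0 p) = ![heckeElt p i, heckeElt p i] := by
      ext r : 1
      fin_cases r <;> rfl
    rw [← actDRows_const, hc]
    refine congrArg μ.1 (Subtype.ext (funext fun w => ?_))
    exact sub_extFun_resFun_apply_of_ne f
      fun h => (norm_det_actRows_heckeElt i i w).1 h rfl
  · have : pullRows ![heckeElt p i, heckeElt p j] (f - extFun (resFun f)) = 0 :=
      Subtype.ext (funext fun w =>
        sub_extFun_resFun_apply_of_eq f ((norm_det_actRows_heckeElt i j w).2 hij))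
    exact (congrArg μ.1 this).trans (map_zero _)

end Support

theorem Up_prodForm (h₁ : IsForm ψ φ₁) (h₂ : IsForm ψ φ₂) {α₁ : O₁} (hα₁ : Up φ₁ = α₁ • φ₁)
    {α₂ : O₂} (hα₂ : Up φ₂ = α₂ • φ₂) :
    Up (prodForm φ₁ φ₂) = (inl F O₁ O₂ α₁ * inr F O₁ O₂ α₂) •
      (prodForm φ₁ φ₂ - fun x => push0 (res0 (prodForm φ₁ φ₂ x))) := by
  funext x
  have e₁ : α₁ • φ₁ x = ∑ j : Fin p, actD (φ₁ (heckeRep a b j * x)) (heckeElt p j) := by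
    rw [← Up_apply h₁.2, hα₁, Pi.smul_apply]
  have e₂ : α₂ • φ₂ x = ∑ j : Fin p, actD (φ₂ (heckeRep a b j * x)) (heckeElt p j) := by
    rw [← Up_apply h₂.2, hα₂, Pi.smul_apply]
  -- The product of the two eigenvalue equations, expanded by bilinearity into all pairs `(i, j)`.
  have e : (inl F O₁ O₂ α₁ * inr F O₁ O₂ α₂) • prodForm φ₁ φ₂ x =
      ∑ i : Fin p, ∑ j : Fin p, actDRows
        (prodDistr (φ₁ (heckeRep a b i * x)) (φ₂ (heckeRep a b j * x)))
        ![heckeElt p i, heckeElt p j] := by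
    rw [prodForm, ← prodDistr_smul_smul, e₁, e₂, prodDistr_sum_sum]
    refine Finset.sum_congr rfl fun i _ => Finset.sum_congr rfl fun j _ => ?_
    exact (isProduct_iff.1 (isProduct_prodDistr.actDRows ![heckeElt p i, heckeElt p j])).symm
  rw [Up_apply (h₁.prodForm h₂).2]
  refine Subtype.ext (LinearMap.ext fun f => ?_)
  -- Testing on the cut-off of `f` leaves the diagonal of the double sum, which is `U_p` of the
  -- product tested on `f` itself.
  have h3 := congrArg (fun μ : Distr F (W p (Fin 2)) (boxplus k₁ k₂) =>
    μ.1 (f - extFun (resFun f))) e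
  simp only [sum_distr_apply, actDRows_heckeElt_apply, Finset.sum_ite_eq, Finset.mem_univ,
    if_true] at h3
  rw [sum_distr_apply]
  refine h3.symm.trans ?_
  exact congrArg ((inl F O₁ O₂ α₁ * inr F O₁ O₂ α₂) * ·) (sub_push0_res0_apply _ f).symm

end ProductForm

end QuatForms

end

theorem propositionP (p : ℕ) [Fact p.Prime]
    (F : Type*) [NormedField F] [NormedAlgebra ℚ_[p] F] [CompleteSpace F]
    (O₁ : Type*) [NormedCommRing O₁] [NormedAlgebra F O₁] [CompleteSpace O₁] [IsUltrametricDist O₁]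
    (O₂ : Type*) [NormedCommRing O₂] [NormedAlgebra F O₂] [CompleteSpace O₂] [IsUltrametricDist O₂]
    -- the definite quaternion algebra `B = (a, b)` over `ℚ`, with a splitting at `p`
    (a b : ℚ) (ha : a < 0) (hb : b < 0)
    (ψ : Bp p a b ≃ₐ[ℚ_[p]] Matrix (Fin 2) (Fin 2) ℚ_[p])
    (k₁ : Weight (p := p) F O₁) (k₂ : Weight (p := p) F O₂)
    (φ₁ : Bf p a b → Distr F (W p Unit) k₁.single) (hφ₁ : IsForm ψ φ₁)
    (φ₂ : Bf p a b → Distr F (W p Unit) k₂.single) (hφ₂ : IsForm ψ φ₂)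
    (α₁ : O₁) (hα₁ : Up φ₁ = α₁ • φ₁) (α₂ : O₂) (hα₂ : Up φ₂ = α₂ • φ₂) :
    -- `Φ` is `φ₁ ⊗ φ₂`
    ∃ Φ : Bf p a b → Distr F (W p (Fin 2)) (boxplus k₁ k₂),
      (∀ x μ, IsProduct (φ₁ x) (φ₂ x) μ ↔ μ = Φ x) ∧
      IsForm ψ Φ ∧
      Up Φ = (inl F O₁ O₂ α₁ * inr F O₁ O₂ α₂) • (Φ - fun x => push0 (res0 (Φ x))) := by
  exact ⟨prodForm φ₁ φ₂, fun x μ => isProduct_iff, hφ₁.prodForm hφ₂,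
    Up_prodForm hφ₁ hφ₂ hα₁ hα₂⟩
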